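/- Let $T$ be a complete (one-sorted) first-order theory and let $\mathfrak C\models T$ be a monster model: for some infinite cardinal $\kappa$, $\mathfrak C$ is $\kappa$-saturated and every partial elementary map with domain of size $<\kappa$ extends to an automorphism; *small* means of size $<\kappa$. The home sort is $\mathfrak C$ itself, and $\mathfrak C^{eq}$ is its expansion by imaginaries. **Definitions.** Let $E$ be a definable equivalence relation on a definable set $D$ of home-sort tuples. A definable (with parameters) $Z\subseteq D$ *splits* a class of $E$ if that class contains $x,y$ with $\mathrm{tp}(x/\emptyset)=\mathrm{tp}(y/\emptyset)$, $x\in Z$ and $y\notin Z$. $E$ is *weakly opaque* if every definable $Z\subseteq D$ splits only finitely many classes of $E$. For a set $C$ of parameters in $\mathfrak C^{eq}$, a sequence $(a_0,\dots,a_{N-1})$ of imaginaries is a *weakly opaque sequence over $C$* if each $a_n$ can be written $a_n=b_n/E_n$, where $b_n$ is a tuple of the home sort and $E_n$ is a weakly opaque equivalence relation definable over $A_n=C\cup\{a_j : j<n\}$ (the quotient of the domain of $E_n$ being identified, over $A_n$, with a subset of a sort of $\mathfrak C^{eq}$). A tuple $\bar a$ of imaginaries is *weakly opaquely layered over $C$*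 if there is a weakly opaque sequence $\bar s$ over $C$ with $\mathrm{dcl}^{eq}(C\bar s)=\mathrm{dcl}^{eq}(C\bar a)$. For a finite home-sort tuple $x$, $\mathrm{tp}(x/A)$ is *relatively isolated* if there is a formula $\varphi\in \mathrm{tp}(x/A)$ with $\mathrm{tp}(x/\emptyset)\cup\{\varphi\}\vdash \mathrm{tp}(x/A)$; the type of a finite set is that of a tuple enumerating it. **(1) Pre-resolutions.** Let $C\subseteq\mathfrak C^{eq}$ be small and let $(a_0,\dots,a_{N-1})$ be a weakly opaque sequence over $C$, with $a_n=b_n/E_n$ and $A_n$ as above. Define $B_N=\emptyset$ and, for $n=N-1,\dots,0$, $B_n=B_{n+1}$ if $a_n\in\mathrm{acl}^{eq}(A_n\cup B_{n+1})$, and $B_n=B_{n+1}\cup\{b_n\}$ otherwise. Then $\{a_0,\dots,a_{N-1}\}\subseteq \mathrm{acl}^{eq}(B_0\cup C)$, and $\mathrm{tp}(B_0/C a_0\dots a_{N-1})$ is relatively isolated. **(2) Resolutions.** Suppose that every algebraically closed subset of $\mathfrak C$ is a model (the universe of an elementary submodel of $\mathfrak C$), and that every finite subset of $\mathfrak C$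 is coded by a finite tuple of $\mathfrak C$ (an automorphism preserves the set if and only if it fixes the tuple). Let $C\subseteq\mathfrak C$ be small and let $\bar a=(a_0,\dots,a_{N-1})$ be a tuple of imaginaries that is weakly opaquely layered over $C$. Then there is a set $B\subseteq\mathfrak C$ of the form $B=C\cup F_0$ with $F_0$ finite, such that $C\bar a\subseteq\mathrm{dcl}^{eq}(B)$ and $\mathrm{tp}(B/C\bar a)$ is relatively isolated, in the sense that $\mathrm{tp}(F/C\bar a)$ is relatively isolated for every finite $F$ with $F_0\subseteq F\subseteq B$. -/

import Mathlib

open FirstOrder FirstOrder.Language Cardinal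

universe u v w

namespace WeakOpacity


/-! ### Monster models -/

section Monster

variable (L : FirstOrder.Language.{u, v}) (M : Type w) [L.Structure M]

/-- `M` is `κ`-saturated (every partial type over fewer than `κ` parameters, in fewer than `κ`
variables, that is finitely satisfiable in `M` is realized in `M`) and strongly `κ`-homogeneous
(every partial elementary map with domain of size `< κ` extends to an automorphism of `M`).
"Small" means "of cardinality less than `κ`". -/
structure IsMonster (κ : Cardinal.{w}) : Prop where
  infinite : ℵ₀ ≤ κ
  saturated : ∀ (A : Set M) (α : Type w), #A < κ → #α < κ →
    ∀ p : Set (L.Formula (A ⊕ α)),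
      (∀ q : Set (L.Formula (A ⊕ α)), q ⊆ p → q.Finite →
        ∃ x : α → M, ∀ φ ∈ q, φ.Realize (Sum.elim Subtype.val x)) →
      ∃ x : α → M, ∀ φ ∈ p, φ.Realize (Sum.elim Subtype.val x)
  homogeneous : ∀ (A : Set M) (f : A → M), #A < κ →
    (∀ φ : L.Formula A, φ.Realize (Subtype.val : A → M) ↔ φ.Realize f) →
    ∃ σ : M ≃[L] M, ∀ a : A, σ a = f a

end Monster

/-! ### Imaginaries -/

section Imaginaries

variable (L : FirstOrder.Language.{u, v}) (M : Type w) [L.Structure M]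

/-- A sort of `M^eq`: an equivalence relation on a finite power of `M`, definable without
parameters. -/
structure ImSort where
  arity : ℕ
  rel : Setoid (Fin arity → M)
  definable : (∅ : Set M).Definable L
    {x : Fin arity ⊕ Fin arity → M | rel (x ∘ Sum.inl) (x ∘ Sum.inr)}

/-- The elements of `M^eq`: a sort together with a class of the corresponding equivalence
relation. -/
abbrev Imaginary : Type w := Σ s : ImSort L M, Quotient s.rel

/-- The home sort `M`, as the sort of the equality relation on `M¹`. -/
def homeSort : ImSort L M where
  arity := 1
  rel := ⊥
  definable := by
    refine Set.empty_definable_iff.2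
      ⟨(Term.var (Sum.inl 0)).equal (Term.var (Sum.inr 0)), ?_⟩
    ext x
    change (x ∘ Sum.inl = x ∘ Sum.inr) ↔ Formula.Realize _ x
    rw [Formula.realize_equal]
    constructor
    · intro h
      exact congrFun h 0
    · intro h
      funext i
      rw [Subsingleton.elim i 0]
      exact h

variable {M}

/-- The inclusion of the home sort into `M^eq`. -/
def home (x : M) : Imaginary L M :=
  ⟨homeSort L M, Quotient.mk (homeSort L M).rel (fun _ => x)⟩

variable {L}

/-- The number of home-sort coordinates of a representative of `a`. -/
abbrev Imaginary.arity (a : Imaginary L M) : ℕ := a.1.arity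

/-- The equivalence class of home-sort tuples that the imaginary `a` is. -/
def Imaginary.cls (a : Imaginary L M) : Set (Fin a.arity → M) :=
  {r | Quotient.mk a.1.rel r = a.2}

variable {α : Type*}

/-- `X ⊆ M^α` is definable in `M^eq` over the set `A` of imaginaries: it is defined by a formula
with finitely many parameters `e₀, …, e_{m-1}` from `A`. A formula `φ(x, z)` of `L^eq` with `x` in
the home sort and `z` in imaginary sorts is the same as a formula `φ(x, y)` of `L` in which the
imaginary variables are replaced by tuples of variables for representatives, and whose truth
at `e` does not depend on the representatives. -/
def DefinableOver (A : Set (Imaginary L M)) (X : Set (α → M)) : Prop :=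
  ∃ (m : ℕ) (e : Fin m → Imaginary L M), (∀ i, e i ∈ A) ∧
    ∃ φ : L.Formula (α ⊕ (Σ i : Fin m, Fin (e i).arity)),
      ∀ r : (i : Fin m) → Fin (e i).arity → M, (∀ i, r i ∈ (e i).cls) →
        ∀ x : α → M, x ∈ X ↔ φ.Realize (Sum.elim x (fun p => r p.1 p.2))

/-- `dcl^eq(A)`: the imaginaries `a` such that `{a}` is definable over `A`. -/
def dclEq (A : Set (Imaginary L M)) : Set (Imaginary L M) :=
  {a | DefinableOver A a.cls}

/-- `acl^eq(A)`: the imaginaries that lie in a finite subset `F` of their sort which is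
definable over `A`. -/
def aclEq (A : Set (Imaginary L M)) : Set (Imaginary L M) :=
  {a | ∃ F : Set (Quotient a.1.rel), F.Finite ∧ a.2 ∈ F ∧
    DefinableOver A {r : Fin a.1.arity → M | Quotient.mk a.1.rel r ∈ F}}

variable (L)

/-- Algebraic closure in the home sort. -/
def acl (A : Set M) : Set M :=
  {x | ∃ X : Set M, X.Finite ∧ x ∈ X ∧ A.Definable₁ L X}

variable (M)

/-- Algebraically closed subsets of the home sort are models, that is, universes of elementary
submodels of `M`. -/
def AclSetsAreModels : Prop :=
  ∀ A : Set M, acl L A = A → ∃ S : L.ElementarySubstructure M, (S : Set M) = A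

/-- Every finite subset of the home sort is coded by a finite tuple of the home sort: an
automorphism preserves the set if and only if it fixes the tuple. -/
def CodesFiniteSets : Prop :=
  ∀ F : Set M, F.Finite → ∃ (m : ℕ) (c : Fin m → M),
    ∀ σ : M ≃[L] M, σ '' F = F ↔ ∀ i, σ (c i) = c i

end Imaginaries

/-! ### Types and relative isolation -/

section Types

variable (L : FirstOrder.Language.{u, v}) {M : Type w} [L.Structure M] {α : Type*}

/-- `tp(x/∅) = tp(y/∅)` for tuples of the home sort. -/
def SameType (x y : α → M) : Prop :=
  ∀ φ : L.Formula α, φ.Realize x ↔ φ.Realize y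

variable {L}

/-- `tp(x/A) = tp(y/A)` for tuples of the home sort and a set `A` of imaginaries. -/
def SameTypeOver (A : Set (Imaginary L M)) (x y : α → M) : Prop :=
  ∀ X : Set (α → M), DefinableOver A X → (x ∈ X ↔ y ∈ X)

/-- `tp(x/A)` is relatively isolated: some formula `φ ∈ tp(x/A)`, with set of realizations `X`,
satisfies `tp(x/∅) ∪ {φ} ⊢ tp(x/A)`. (In a monster model, and for small `A`, entailment between
types is inclusion of their sets of realizations.) -/
def RelIsolated (A : Set (Imaginary L M)) (x : α → M) : Prop :=
  ∃ X : Set (α → M), DefinableOver A X ∧ x ∈ X ∧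
    ∀ y : α → M, SameType L x y → y ∈ X → SameTypeOver A x y

/-- `tp(F/A)` is relatively isolated, for a subset `F` of the home sort, viewed as the tuple of
its elements. -/
def RelIsolatedSet (A : Set (Imaginary L M)) (F : Set M) : Prop :=
  RelIsolated A (Subtype.val : F → M)

end Types

/-! ### Weak opacity -/

section Opacity

variable (L : FirstOrder.Language.{u, v}) {M : Type w} [L.Structure M] {k : ℕ}

/-- `Z` splits the class `q` of the equivalence relation `E` on `D`: there are `x, y` in `q` with
the same type over `∅`, the first in `Z` and the second not. -/
def Splits {D : Set (Fin k → M)} (E : Setoid D) (Z : Set (Fin k → M)) (q : Quotient E) : Prop :=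
  ∃ x y : D, Quotient.mk E x = q ∧ Quotient.mk E y = q ∧
    SameType L (x : Fin k → M) (y : Fin k → M) ∧ (x : Fin k → M) ∈ Z ∧ (y : Fin k → M) ∉ Z

/-- `E` is weakly opaque: every definable (with parameters) `Z ⊆ D` splits only finitely many
classes of `E`. -/
def WeaklyOpaque {D : Set (Fin k → M)} (E : Setoid D) : Prop :=
  ∀ Z : Set (Fin k → M), Z ⊆ D → (Set.univ : Set M).Definable L Z →
    {q : Quotient E | Splits L E Z q}.Finite

variable {L}

/-- A presentation `a = b/E` of the imaginary `a` as a class of a weakly opaque equivalence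
relation `E`, definable over `A`, on a set `D` of home-sort tuples. The quotient `D/E` lives in
`M^eq` by means of an injection `code`, definable over `A`, into the sort of `a`. -/
structure OpaquePresentation (A : Set (Imaginary L M)) (a : Imaginary L M) where
  arity : ℕ
  D : Set (Fin arity → M)
  E : Setoid D
  definable : DefinableOver A {x : Fin arity ⊕ Fin arity → M |
    ∃ (hx : x ∘ Sum.inl ∈ D) (hy : x ∘ Sum.inr ∈ D), E ⟨x ∘ Sum.inl, hx⟩ ⟨x ∘ Sum.inr, hy⟩}
  opaque_rel : WeaklyOpaque L E
  code : Quotient E → Quotient a.1.rel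
  code_injective : Function.Injective code
  code_definable : DefinableOver A {x : Fin arity ⊕ Fin a.1.arity → M |
    ∃ hx : x ∘ Sum.inl ∈ D,
      code (Quotient.mk E ⟨x ∘ Sum.inl, hx⟩) = Quotient.mk a.1.rel (x ∘ Sum.inr)}
  b : D
  code_b : code (Quotient.mk E b) = a.2

variable {N : ℕ}

/-- The parameter set `A_n = C ∪ {a_j | j < n}`. -/
def initialParams (C : Set (Imaginary L M)) (a : Fin N → Imaginary L M) (n : Fin N) :
    Set (Imaginary L M) :=
  C ∪ {e | ∃ j, j < n ∧ e = a j}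

/-- `(a_0, …, a_{N-1})` is a weakly opaque sequence over `C`. -/
def IsWeaklyOpaqueSeq (C : Set (Imaginary L M)) (a : Fin N → Imaginary L M) : Prop :=
  ∀ n : Fin N, Nonempty (OpaquePresentation (initialParams C a n) (a n))

/-- The tuple `a` of imaginaries is weakly opaquely layered over `C`: it is interdefinable over
`C` with a weakly opaque sequence over `C`. -/
def IsWeaklyOpaquelyLayered (C : Set (Imaginary L M)) (a : Fin N → Imaginary L M) : Prop :=
  ∃ (n : ℕ) (s : Fin n → Imaginary L M), IsWeaklyOpaqueSeq C s ∧
    dclEq (C ∪ Set.range s) = dclEq (C ∪ Set.range a)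

variable {C : Set (Imaginary L M)} {a : Fin N → Imaginary L M}

/-- The subset of the home sort formed by the coordinates of the tuples `b_i`, `i ∈ I`. -/
def repSet (W : ∀ n, OpaquePresentation (initialParams C a n) (a n)) (I : Set (Fin N)) : Set M :=
  {x | ∃ i ∈ I, ∃ j : Fin (W i).arity, x = (W i).b.1 j}

open Classical in
/-- The sets of indices of the representatives kept in `B_N, B_{N-1}, …, B_0`, by downward
recursion: `B_N = ∅`, and `B_n` is `B_{n+1}` or `B_{n+1} ∪ {b_n}` according to whether
`a_n ∈ acl^eq(A_n ∪ B_{n+1})` or not. -/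
noncomputable def keptIndices (W : ∀ n, OpaquePresentation (initialParams C a n) (a n)) :
    Fin (N + 1) → Set (Fin N) :=
  Fin.reverseInduction (motive := fun _ => Set (Fin N)) ∅
    (fun n I => if a n ∈ aclEq (initialParams C a n ∪ home L '' repSet W I) then I
      else insert n I)

/-- The set `B_n ⊆ {b_0, …, b_{N-1}}` of representatives, as a subset of the home sort. -/
noncomputable def chosenReps (W : ∀ n, OpaquePresentation (initialParams C a n) (a n))
    (n : Fin (N + 1)) : Set M :=
  repSet W (keptIndices W n)

end Opacity

end WeakOpacity

namespace WeakOpacity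

variable {L : FirstOrder.Language.{u, v}} {M : Type w} [L.Structure M] {α β γ : Type*}

/-! ### Definable sets in the home sort -/

/-! In a monster model, notions over a small set `A` of imaginaries become statements about
automorphisms fixing `A`. Types are orbits (`exists_fixes_of_sameTypeOver`), invariant definable
sets are definable over `A` (`exists_definableOver_fiber`), algebraic means having a finite orbit,
and being in the definable closure means being fixed. Relative isolation becomes `OrbitIsolated`.

The heart is `mem_of_sameType`. Let `a = b/E` with `E` weakly opaque over `A`, and let `B ⊇ A` with
`a` not algebraic over `B`. A `B`-definable set splitting the class of `a` would split the classes
of its infinitely many conjugates over `B`, contradicting weak opacity. So the type of `b` over `∅`,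
together with "the class is `a`", determines its type over `B`, and even over `Ba`: this is
`orbitIsolated_representative`.

Pre-resolutions follow by downward induction. A representative `b_n` is added only when `a_n` is not
algebraic over `A_n ∪ B_{n+1}`, exactly the hypothesis of that lemma. Algebraic elements may be
added to the base (`orbitIsolated_insert`), and relative isolation is transitive
(`orbitIsolated_elim`).

For resolutions, let `B₀` be the pre-resolution of an interdefinable weakly opaque sequence. Since
`acl(C ∪ B₀)` is a model, the imaginaries of the sequence, algebraic over `C ∪ B₀`, have
representatives in it. These are algebraic over `C ∪ B₀`, so adding them to `B₀` preserves relative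
isolation. -/

theorem definable_apply_iff {A : Set M} {s : Set (α → M)} (hs : A.Definable L s) (σ : M ≃[L] M)
    (hσ : ∀ a ∈ A, σ a = a) (x : α → M) : σ ∘ x ∈ s ↔ x ∈ s := by
  obtain ⟨φ, rfl⟩ := Set.definable_iff_exists_formula_sum.1 hs
  have h : Sum.elim (Subtype.val : A → M) (σ ∘ x) = σ ∘ Sum.elim (Subtype.val : A → M) x := by
    funext i
    rcases i with a | i
    · exact (hσ a a.2).symm
    · rfl
  change φ.Realize _ ↔ φ.Realize _
  rw [h]
  exact StrongHomClass.realize_formula σ φ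

theorem definable_eq {A : Set M} (i j : α) : A.Definable L {x : α → M | x i = x j} :=
  ⟨(Term.var i).equal (Term.var j), by ext; simp⟩

theorem exists_definable_params {A : Set M} {s : Set (α → M)} (hs : A.Definable L s) :
    ∃ s' : Set (α ⊕ A → M), (∅ : Set M).Definable L s' ∧
      s = {x | Sum.elim x Subtype.val ∈ s'} := by
  obtain ⟨φ, rfl⟩ := Set.definable_iff_exists_formula_sum.1 hs
  refine ⟨{y | φ.Realize (y ∘ Sum.swap)}, Set.empty_definable_iff.2
    ⟨φ.relabel Sum.swap, ?_⟩, ?_⟩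
  · ext y
    exact Formula.realize_relabel.symm
  · ext x
    change φ.Realize _ ↔ φ.Realize _
    rw [Sum.elim_swap]

theorem definable_fiber {A : Set M} {s : Set (α ⊕ β → M)} (hs : A.Definable L s) (y : β → M) :
    (A ∪ Set.range y).Definable L {x : α → M | Sum.elim x y ∈ s} := by
  obtain ⟨φ, rfl⟩ := Set.definable_iff_exists_formula_sum.1 hs
  refine Set.definable_iff_exists_formula_sum.2
    ⟨φ.relabel (Sum.elim (fun a : A => Sum.inl ⟨a, Or.inl a.2⟩)
      (Sum.elim Sum.inr (fun b => Sum.inl ⟨y b, Or.inr ⟨b, rfl⟩⟩))), ?_⟩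
  ext x
  simp only [Set.mem_ofPred_eq, Formula.realize_relabel]
  refine iff_of_eq (congrArg φ.Realize (funext fun i => ?_))
  rcases i with a | i | b <;> rfl

/-- Only the free variables of a formula matter. This reduces conditions on an infinite tuple of
representatives to finitely many imaginaries. -/
theorem exists_finite_support {A : Set M} {s : Set (α → M)} (hs : A.Definable L s) :
    ∃ (t : Finset α) (s' : Set (t → M)), A.Definable L s' ∧
      s = {x | x ∘ Subtype.val ∈ s'} := by
  classical
  obtain ⟨φ, rfl⟩ := hs
  refine ⟨φ.freeVarFinset, _, ⟨φ.restrictFreeVar id, rfl⟩, ?_⟩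
  ext x
  exact (BoundedFormula.realize_restrictFreeVar (f := id) x (fun _ => rfl)).symm

theorem exists_fin_params {s : Set (α → M)} (hs : (Set.univ : Set M).Definable L s) :
    ∃ (k : ℕ) (m : Fin k → M) (P : Set (α ⊕ Fin k → M)), (∅ : Set M).Definable L P ∧
      s = {x | Sum.elim x m ∈ P} := by
  obtain ⟨A, -, hA⟩ := Set.definable_iff_finitely_definable.1 hs
  obtain ⟨P, hP, rfl⟩ := exists_definable_params hA
  let f := Fintype.equivFin (A : Set M)
  refine ⟨_, (Subtype.val : ↥(A : Set M) → M) ∘ f.symm, _, hP.preimage_comp (Sum.map id f), ?_⟩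
  ext x
  rw [Set.mem_ofPred_eq, Set.mem_ofPred_eq]
  have : Sum.elim x ((Subtype.val : ↥(A : Set M) → M) ∘ f.symm) ∘ Sum.map id f
      = Sum.elim x (Subtype.val : ↥(A : Set M) → M) := by
    funext i
    rcases i with i | i
    · rfl
    · change ((f.symm (f i) : (A : Set M)) : M) = i
      rw [f.symm_apply_apply]
  rw [Set.mem_preimage, this]

theorem definable_singleton_tuple [Finite α] (x : α → M) :
    (Set.range x).Definable L ({x} : Set (α → M)) := by
  have h : ∀ i, (Set.range x).Definable L {y : α → M | y i = x i} := fun i =>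
    (Set.Definable.singleton_of_mem L (Set.mem_range_self i)).preimage_comp (fun _ : Fin 1 => i)
  convert! Set.definable_iInter_of_finite h using 1
  ext y
  simp [funext_iff]

theorem definable_of_finite [Finite α] {s : Set (α → M)} (hs : s.Finite) :
    (Set.univ : Set M).Definable L s := by
  induction s, hs using Set.Finite.induction_on with
  | empty => exact Set.definable_empty
  | insert _ _ ih =>
    rw [Set.insert_eq]
    exact ((definable_singleton_tuple _).mono (Set.subset_univ _)).union ih

theorem sameType_iff {x y : α → M} : SameType L x y ↔
    ∀ P : Set (α → M), (∅ : Set M).Definable L P → (x ∈ P ↔ y ∈ P) := by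
  constructor
  · intro h P hP
    obtain ⟨φ, rfl⟩ := Set.empty_definable_iff.1 hP
    exact h φ
  · intro h φ
    exact h _ (Set.empty_definable_iff.2 ⟨φ, rfl⟩)

theorem sameType_of_forall {x y : α → M}
    (h : ∀ P : Set (α → M), (∅ : Set M).Definable L P → x ∈ P → y ∈ P) : SameType L x y :=
  sameType_iff.2 fun P hP => ⟨h P hP, fun hy => by
    by_contra hx
    exact h _ hP.compl hx hy⟩

theorem SameType.symm {x y : α → M} (h : SameType L x y) : SameType L y x :=
  fun φ => (h φ).symm

theorem SameType.trans {x y z : α → M} (h : SameType L x y) (h' : SameType L y z) :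
    SameType L x z :=
  fun φ => (h φ).trans (h' φ)

theorem SameType.comp {x y : α → M} (h : SameType L x y) (f : β → α) :
    SameType L (x ∘ f) (y ∘ f) := fun φ => by
  simpa only [Formula.realize_relabel] using h (φ.relabel f)

theorem SameType.apply_eq {x y : α → M} (h : SameType L x y) {i j : α} (hx : x i = x j) :
    y i = y j :=
  (sameType_iff.1 h _ (definable_eq i j)).1 hx

theorem sameType_comp (σ : M ≃[L] M) (x : α → M) : SameType L x (σ ∘ x) := fun φ =>
  (StrongHomClass.realize_formula σ φ).symm

/-! ### Saturation and homogeneity in the home sort -/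

namespace IsMonster

variable {κ : Cardinal.{w}}

/-- Saturation, applied to a family of definable sets closed under intersections. -/
theorem sInter_nonempty (hM : IsMonster L M κ) {A : Set M} (hA : #A < κ) {β : Type w}
    (hβ : #β < κ) (p : Set (Set (β → M))) (hp : ∀ s ∈ p, A.Definable L s)
    (hne : p.Nonempty) (hinter : ∀ s ∈ p, ∀ t ∈ p, s ∩ t ∈ p) (hp' : ∀ s ∈ p, s.Nonempty) :
    (⋂₀ p).Nonempty := by
  have hfin : ∀ q : Set (Set (β → M)), q.Finite → q ⊆ p → ∃ s ∈ p, s ⊆ ⋂₀ q := by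
    intro q hq
    induction q, hq using Set.Finite.induction_on with
    | empty => exact fun _ => hne.imp fun s hs => ⟨hs, by simp⟩
    | @insert t q _ _ ih =>
      intro h
      obtain ⟨s, hs, hsq⟩ := ih ((Set.subset_insert t q).trans h)
      refine ⟨t ∩ s, hinter _ (h (Set.mem_insert t q)) _ hs, ?_⟩
      rw [Set.sInter_insert]
      exact Set.inter_subset_inter_right t hsq
  choose! φ hφ using fun s hs => Set.definable_iff_exists_formula_sum.1 (hp s hs)
  obtain ⟨x, hx⟩ := hM.saturated A β hA hβ (φ '' p) (by
    intro q hq hqf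
    obtain ⟨t, htp, htf, rfl⟩ := Set.exists_subset_image_finite_and (p := (· = q)).1 ⟨q, hq, hqf, rfl⟩
    obtain ⟨s₀, hs₀, hst⟩ := hfin t htf htp
    obtain ⟨x, hx⟩ := hp' s₀ hs₀
    replace hx := hst hx
    refine ⟨x, ?_⟩
    rintro _ ⟨s, hs, rfl⟩
    have := hx s hs
    rw [hφ s (htp hs)] at this
    exact this)
  refine ⟨x, fun s hs => ?_⟩
  rw [hφ s hs]
  exact hx _ ⟨s, hs, rfl⟩

theorem exists_equiv_of_sameType (hM : IsMonster L M κ) {x y : α → M}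
    (hx : #(Set.range x) < κ) (h : SameType L x y) : ∃ σ : M ≃[L] M, σ ∘ x = y := by
  -- The tuple may have repetitions, so homogeneity is applied to its range, with one index chosen
  -- for each element.
  choose g hg using fun a : Set.range x => a.2
  have hgx : ∀ i, y (g ⟨x i, i, rfl⟩) = y i := fun i => h.apply_eq (hg ⟨x i, i, rfl⟩)
  obtain ⟨σ, hσ⟩ := hM.homogeneous (Set.range x) (y ∘ g) hx (by
    intro φ
    have h' := h.comp g φ
    rwa [show x ∘ g = Subtype.val from funext hg] at h')
  refine ⟨σ, funext fun i => ?_⟩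
  rw [← hgx i]
  exact hσ ⟨x i, i, rfl⟩

/-- Saturation for finitely many variables, applied to a family closed under intersections. -/
theorem sInter_nonempty_of_finite (hM : IsMonster L M κ) {A : Set M} (hA : #A < κ) [Finite α]
    (p : Set (Set (α → M))) (hp : ∀ s ∈ p, A.Definable L s) (hne : p.Nonempty)
    (hinter : ∀ s ∈ p, ∀ t ∈ p, s ∩ t ∈ p) (hp' : ∀ s ∈ p, s.Nonempty) :
    (⋂₀ p).Nonempty := by
  obtain ⟨n, ⟨f⟩⟩ := Finite.exists_equiv_fin α
  let g : α ≃ ULift.{w} (Fin n) := f.trans Equiv.ulift.symm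
  let F : Set (α → M) → Set (ULift.{w} (Fin n) → M) := fun s => {y | y ∘ g ∈ s}
  obtain ⟨y, hy⟩ := hM.sInter_nonempty hA
    ((lt_aleph0_of_finite (ULift.{w} (Fin n))).trans_le hM.infinite) (F '' p)
    (by rintro _ ⟨s, hs, rfl⟩; exact (hp s hs).preimage_comp g)
    (hne.image F)
    (by rintro _ ⟨s, hs, rfl⟩ _ ⟨t, ht, rfl⟩; exact ⟨_, hinter s hs t ht, rfl⟩)
    (by
      rintro _ ⟨s, hs, rfl⟩
      obtain ⟨x, hx⟩ := hp' s hs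
      refine ⟨x ∘ g.symm, ?_⟩
      change (x ∘ g.symm) ∘ g ∈ s
      refine Set.mem_of_eq_of_mem (funext fun i => ?_) hx
      change x (g.symm (g i)) = x i
      rw [g.symm_apply_apply])
  exact ⟨y ∘ g, fun s hs => hy _ ⟨s, hs, rfl⟩⟩

end IsMonster

/-! ### Automorphisms acting on imaginaries -/

theorem ImSort.rel_apply_iff (s : ImSort L M) (σ : M ≃[L] M) (x y : Fin s.arity → M) :
    s.rel (σ ∘ x) (σ ∘ y) ↔ s.rel x y := by
  have h := definable_apply_iff s.definable σ (by simp) (Sum.elim x y)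
  rwa [Sum.comp_elim] at h

/-- The action of an automorphism on imaginaries. -/
def act (σ : M ≃[L] M) (e : Imaginary L M) : Imaginary L M :=
  ⟨e.1, Quotient.map (σ ∘ ·) (fun x y h => (e.1.rel_apply_iff σ x y).2 h) e.2⟩

theorem act_mk (σ : M ≃[L] M) (s : ImSort L M) (r : Fin s.arity → M) :
    act σ ⟨s, Quotient.mk s.rel r⟩ = ⟨s, Quotient.mk s.rel (σ ∘ r)⟩ := rfl

theorem act_home (σ : M ≃[L] M) (x : M) : act σ (home L x) = home L (σ x) := rfl

theorem act_comp (σ τ : M ≃[L] M) (e : Imaginary L M) :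
    act (σ.comp τ) e = act σ (act τ e) := by
  obtain ⟨s, q⟩ := e
  induction q using Quotient.inductionOn
  rfl

theorem act_refl (e : Imaginary L M) : act (Language.Equiv.refl L M) e = e := by
  obtain ⟨s, q⟩ := e
  induction q using Quotient.inductionOn
  rfl

theorem symm_comp_tuple (σ : M ≃[L] M) (x : α → M) : σ.symm ∘ (σ ∘ x) = x :=
  funext fun i => σ.symm_apply_apply (x i)

theorem comp_symm_tuple (σ : M ≃[L] M) (x : α → M) : σ ∘ (σ.symm ∘ x) = x :=
  funext fun i => σ.apply_symm_apply (x i)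

theorem act_symm_act (σ : M ≃[L] M) (e : Imaginary L M) : act σ.symm (act σ e) = e := by
  obtain ⟨s, q⟩ := e
  induction q using Quotient.inductionOn with | _ r
  rw [act_mk, act_mk, symm_comp_tuple]

theorem act_act_symm (σ : M ≃[L] M) (e : Imaginary L M) : act σ (act σ.symm e) = e := by
  obtain ⟨s, q⟩ := e
  induction q using Quotient.inductionOn with | _ r
  rw [act_mk, act_mk, comp_symm_tuple]

theorem home_injective : Function.Injective (home L (M := M)) := by
  intro x y h
  have h' := eq_of_heq (Sigma.mk.inj h).2
  exact congrFun (Quotient.exact h') (0 : Fin 1)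

/-- The automorphism `σ` fixes each element of `A`. -/
def Fixes (σ : M ≃[L] M) (A : Set (Imaginary L M)) : Prop := ∀ e ∈ A, act σ e = e

namespace Fixes

variable {σ τ : M ≃[L] M} {A B : Set (Imaginary L M)}

theorem mono (h : Fixes σ B) (hAB : A ⊆ B) : Fixes σ A := fun e he => h e (hAB he)

theorem refl : Fixes (Language.Equiv.refl L M) A := fun e _ => act_refl e

theorem comp (h : Fixes σ A) (h' : Fixes τ A) : Fixes (σ.comp τ) A := fun e he => by
  rw [act_comp, h' e he, h e he]

theorem symm (h : Fixes σ A) : Fixes σ.symm A := fun e he => by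
  conv_lhs => rw [← h e he]
  exact act_symm_act σ e

theorem union (h : Fixes σ A) (h' : Fixes σ B) : Fixes σ (A ∪ B) := fun e he =>
  he.elim (h e) (h' e)

theorem insert {e : Imaginary L M} (h : Fixes σ A) (h' : act σ e = e) :
    Fixes σ (insert e A) := by
  rintro _ (rfl | he)
  · exact h'
  · exact h _ he

end Fixes

theorem fixes_home_image_iff {σ : M ≃[L] M} {S : Set M} :
    Fixes σ (home L '' S) ↔ ∀ x ∈ S, σ x = x := by
  constructor
  · intro h x hx
    exact home_injective ((act_home σ x).symm.trans (h _ ⟨x, hx, rfl⟩))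
  · rintro h _ ⟨x, hx, rfl⟩
    rw [act_home, h x hx]

theorem fixes_home_range_iff {σ : M ≃[L] M} {x : α → M} :
    Fixes σ (home L '' Set.range x) ↔ σ ∘ x = x := by
  rw [fixes_home_image_iff, Set.forall_mem_range, funext_iff]
  rfl

theorem mem_cls_iff {e : Imaginary L M} {r : Fin e.arity → M} :
    r ∈ e.cls ↔ Quotient.mk e.1.rel r = e.2 := Iff.rfl

theorem exists_mem_cls (e : Imaginary L M) : ∃ r, r ∈ e.cls := Quotient.exists_rep e.2

theorem act_of_mem_cls {e : Imaginary L M} {r : Fin e.arity → M} (hr : r ∈ e.cls)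
    (σ : M ≃[L] M) : act σ e = ⟨e.1, Quotient.mk e.1.rel (σ ∘ r)⟩ := by
  have h : e = ⟨e.1, Quotient.mk e.1.rel r⟩ := Sigma.ext rfl (heq_of_eq hr.symm)
  exact congrArg (act σ) h

theorem act_eq_iff {e : Imaginary L M} {r : Fin e.arity → M} (hr : r ∈ e.cls)
    (σ : M ≃[L] M) : act σ e = e ↔ σ ∘ r ∈ e.cls := by
  rw [act_of_mem_cls hr, mem_cls_iff]
  exact ⟨fun h => eq_of_heq (Sigma.mk.inj h).2, fun h => Sigma.ext rfl (heq_of_eq h)⟩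

theorem rel_iff_of_mem_cls {e : Imaginary L M} {r r' : Fin e.arity → M} (hr : r ∈ e.cls) :
    e.1.rel r' r ↔ r' ∈ e.cls := by
  rw [mem_cls_iff, ← mem_cls_iff.1 hr]
  exact Quotient.eq.symm

theorem cls_definable_of_mem {e : Imaginary L M} {r : Fin e.arity → M} (hr : r ∈ e.cls)
    {A : Set M} (hA : Set.range r ⊆ A) : A.Definable L e.cls := by
  refine Eq.mp ?_ ((definable_fiber e.1.definable r).mono (B := A) (by simpa using hA))
  congr 1
  ext x
  exact rel_iff_of_mem_cls hr

theorem cls_definable (e : Imaginary L M) : (Set.univ : Set M).Definable L e.cls := by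
  obtain ⟨r, hr⟩ := exists_mem_cls e
  exact cls_definable_of_mem hr (Set.subset_univ _)

/-! ### Definability over imaginaries -/

section DefinableOver

variable {A B : Set (Imaginary L M)}

/-- A family of tuples of home-sort elements which represents the family `e` of imaginaries. -/
def Represents {ι : Type*} (e : ι → Imaginary L M) (r : (Σ i, Fin (e i).arity) → M) : Prop :=
  ∀ i, (fun j => r ⟨i, j⟩) ∈ (e i).cls

theorem exists_represents {ι : Type*} (e : ι → Imaginary L M) : ∃ r, Represents e r := by
  choose r hr using fun i => exists_mem_cls (e i)
  exact ⟨fun p => r p.1 p.2, hr⟩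

theorem Represents.act_eq {ι : Type*} {e : ι → Imaginary L M} {r : (Σ i, Fin (e i).arity) → M}
    (h : Represents e r) {σ : M ≃[L] M} (h' : Represents e (σ ∘ r)) (i : ι) :
    act σ (e i) = e i :=
  (act_eq_iff (h i) σ).2 (h' i)

theorem Represents.comp {ι : Type*} {e : ι → Imaginary L M} {r : (Σ i, Fin (e i).arity) → M}
    (h : Represents e r) {σ : M ≃[L] M} (hσ : ∀ i, act σ (e i) = e i) :
    Represents e (σ ∘ r) := fun i => (act_eq_iff (h i) σ).1 (hσ i)

theorem definableOver_iff_fin {X : Set (α → M)} : DefinableOver A X ↔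
    ∃ (m : ℕ) (e : Fin m → Imaginary L M), (∀ i, e i ∈ A) ∧
      ∃ P : Set (α ⊕ (Σ i, Fin (e i).arity) → M), (∅ : Set M).Definable L P ∧
        ∀ r, Represents e r → ∀ x, x ∈ X ↔ Sum.elim x r ∈ P := by
  constructor
  · rintro ⟨m, e, he, φ, hφ⟩
    exact ⟨m, e, he, _, Set.empty_definable_iff.2 ⟨φ, rfl⟩,
      fun r hr x => hφ (fun i j => r ⟨i, j⟩) hr x⟩
  · rintro ⟨m, e, he, P, hP, h⟩
    obtain ⟨φ, rfl⟩ := Set.empty_definable_iff.1 hP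
    exact ⟨m, e, he, φ, fun r hr x => h (fun p => r p.1 p.2) hr x⟩

theorem definable_rel {ι : Type*} [Finite ι] (e : ι → Imaginary L M) : (∅ : Set M).Definable L
    {x : (Σ i, Fin (e i).arity) ⊕ (Σ i, Fin (e i).arity) → M |
      ∀ i, (e i).1.rel (fun j => x (Sum.inl ⟨i, j⟩)) (fun j => x (Sum.inr ⟨i, j⟩))} := by
  have h : ∀ i, (∅ : Set M).Definable L
      {x : (Σ i, Fin (e i).arity) ⊕ (Σ i, Fin (e i).arity) → M |
        (e i).1.rel (fun j => x (Sum.inl ⟨i, j⟩)) (fun j => x (Sum.inr ⟨i, j⟩))} := fun i =>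
    (e i).1.definable.preimage_comp (Sum.map (Sigma.mk i) (Sigma.mk i) :
      _ → (Σ i, Fin (e i).arity) ⊕ (Σ i, Fin (e i).arity))
  convert! Set.definable_iInter_of_finite h using 1
  ext x
  simp

/-- Quantifying over all representatives makes the truth value independent of the chosen ones, as
`DefinableOver` demands. With `exists_form` it gives a normal form on which the closure properties
are checked. -/
theorem definableOver_of_exists_fin {m : ℕ} (e : Fin m → Imaginary L M) (he : ∀ i, e i ∈ A)
    {P : Set (α ⊕ (Σ i, Fin (e i).arity) → M)} (hP : (∅ : Set M).Definable L P) :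
    DefinableOver A {x : α → M | ∃ r, Represents e r ∧ Sum.elim x r ∈ P} := by
  have h₁ := (definable_rel e).preimage_comp
    (Sum.elim (fun p => Sum.inr p) (fun p => Sum.inl (Sum.inr p)) :
      _ → (α ⊕ (Σ i, Fin (e i).arity)) ⊕ (Σ i, Fin (e i).arity))
  have h₂ := hP.preimage_comp
    (Sum.elim (fun a => Sum.inl (Sum.inl a)) (fun p => Sum.inr p) :
      _ → (α ⊕ (Σ i, Fin (e i).arity)) ⊕ (Σ i, Fin (e i).arity))
  refine definableOver_iff_fin.2 ⟨m, e, he, _, (h₁.inter h₂).exists_of_finite, ?_⟩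
  intro r hr x
  refine exists_congr fun r' => ?_
  refine and_congr ?_ ?_
  · exact forall_congr' fun i => (rel_iff_of_mem_cls (hr i)).symm
  · refine iff_of_eq (congrArg (· ∈ P) (funext fun i => ?_))
    rcases i with i | i <;> rfl

theorem definableOver_of_exists {ι : Type*} [Finite ι] (e : ι → Imaginary L M)
    (he : ∀ i, e i ∈ A) {P : Set (α ⊕ (Σ i, Fin (e i).arity) → M)}
    (hP : (∅ : Set M).Definable L P) :
    DefinableOver A {x : α → M | ∃ r, Represents e r ∧ Sum.elim x r ∈ P} := by
  obtain ⟨n, ⟨f⟩⟩ := Finite.exists_equiv_fin ι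
  let g := f.symm
  let G : (Σ k, Fin (e (g k)).arity) ≃ Σ i, Fin (e i).arity :=
    Equiv.sigmaCongrLeft (β := fun i => Fin (e i).arity) g
  refine Eq.mp ?_ (definableOver_of_exists_fin (e ∘ g) (fun k => he (g k))
    (hP.preimage_comp (Sum.map id G.symm)))
  congr 1
  ext x
  constructor
  · rintro ⟨r, hr, h⟩
    refine ⟨r ∘ G.symm, fun i => ?_, ?_⟩
    · obtain ⟨k, rfl⟩ := g.surjective i
      have := hr k
      convert! this using 1
      funext j
      change r (G.symm (G ⟨k, j⟩)) = _
      rw [G.symm_apply_apply]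
    · refine Set.mem_of_eq_of_mem (funext fun i => ?_) h
      rcases i with i | i <;> rfl
  · rintro ⟨r, hr, h⟩
    refine ⟨r ∘ G, fun k => hr (g k), ?_⟩
    change _ ∘ _ ∈ P
    refine Set.mem_of_eq_of_mem (funext fun i => ?_) h
    rcases i with i | i
    · rfl
    · change r (G (G.symm i)) = r i
      rw [G.apply_symm_apply]

theorem DefinableOver.exists_form {X : Set (α → M)} (hX : DefinableOver A X) :
    ∃ (m : ℕ) (e : Fin m → Imaginary L M), (∀ i, e i ∈ A) ∧
      ∃ P : Set (α ⊕ (Σ i, Fin (e i).arity) → M), (∅ : Set M).Definable L P ∧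
        X = {x | ∃ r, Represents e r ∧ Sum.elim x r ∈ P} := by
  obtain ⟨m, e, he, P, hP, h⟩ := definableOver_iff_fin.1 hX
  refine ⟨m, e, he, P, hP, ?_⟩
  ext x
  obtain ⟨r₀, hr₀⟩ := exists_represents e
  exact ⟨fun hx => ⟨r₀, hr₀, (h r₀ hr₀ x).1 hx⟩, fun ⟨r, hr, hx⟩ => (h r hr x).2 hx⟩

theorem DefinableOver.mono {X : Set (α → M)} (hX : DefinableOver A X) (hAB : A ⊆ B) :
    DefinableOver B X := by
  obtain ⟨m, e, he, h⟩ := hX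
  exact ⟨m, e, fun i => hAB (he i), h⟩

theorem DefinableOver.preimage_comp {X : Set (α → M)} (hX : DefinableOver A X) (f : α → β) :
    DefinableOver A ((fun y : β → M => y ∘ f) ⁻¹' X) := by
  obtain ⟨m, e, he, P, hP, h⟩ := definableOver_iff_fin.1 hX
  refine definableOver_iff_fin.2 ⟨m, e, he, _, hP.preimage_comp (Sum.map f id), ?_⟩
  intro r hr y
  rw [Set.mem_preimage, h r hr, Set.mem_preimage]
  refine iff_of_eq (congrArg (· ∈ P) (funext fun i => ?_))
  rcases i with i | i <;> rfl

theorem DefinableOver.inter {X Y : Set (α → M)} (hX : DefinableOver A X)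
    (hY : DefinableOver A Y) : DefinableOver A (X ∩ Y) := by
  obtain ⟨m, e, he, P, hP, rfl⟩ := hX.exists_form
  obtain ⟨n, f, hf, Q, hQ, rfl⟩ := hY.exists_form
  let g : Fin m ⊕ Fin n → Imaginary L M := Sum.elim e f
  have h₁ := hP.preimage_comp (Sum.map id (fun p => ⟨Sum.inl p.1, p.2⟩) :
      _ → α ⊕ Σ i, Fin (g i).arity)
  have h₂ := hQ.preimage_comp (Sum.map id (fun p => ⟨Sum.inr p.1, p.2⟩) :
      _ → α ⊕ Σ i, Fin (g i).arity)
  refine Eq.mp ?_ (definableOver_of_exists g (A := A)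
    (by rintro (i | i); exacts [he i, hf i]) (h₁.inter h₂))
  congr 1
  ext x
  constructor
  · rintro ⟨r, hr, hr₁, hr₂⟩
    refine ⟨⟨fun p => r ⟨Sum.inl p.1, p.2⟩, fun i => hr (Sum.inl i), ?_⟩,
      ⟨fun p => r ⟨Sum.inr p.1, p.2⟩, fun i => hr (Sum.inr i), ?_⟩⟩
    · refine Set.mem_of_eq_of_mem (funext fun i => ?_) hr₁
      rcases i with i | i <;> rfl
    · refine Set.mem_of_eq_of_mem (funext fun i => ?_) hr₂
      rcases i with i | i <;> rfl
  · rintro ⟨⟨r, hr, h⟩, ⟨s, hs, h'⟩⟩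
    let t : (Σ i, Fin (g i).arity) → M := fun p =>
      match p with
      | ⟨Sum.inl i, j⟩ => r ⟨i, j⟩
      | ⟨Sum.inr i, j⟩ => s ⟨i, j⟩
    refine ⟨t, ?_, ?_, ?_⟩
    · rintro (i | i)
      exacts [hr i, hs i]
    · change _ ∘ _ ∈ P
      refine Set.mem_of_eq_of_mem (funext fun i => ?_) h
      rcases i with i | i <;> rfl
    · change _ ∘ _ ∈ Q
      refine Set.mem_of_eq_of_mem (funext fun i => ?_) h'
      rcases i with i | i <;> rfl

theorem DefinableOver.compl {X : Set (α → M)} (hX : DefinableOver A X) :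
    DefinableOver A Xᶜ := by
  obtain ⟨m, e, he, P, hP, h⟩ := definableOver_iff_fin.1 hX
  exact definableOver_iff_fin.2 ⟨m, e, he, _, hP.compl, fun r hr x => not_congr (h r hr x)⟩

theorem definableOver_of_definable {X : Set (α → M)} (hX : (∅ : Set M).Definable L X) :
    DefinableOver A X := by
  refine definableOver_iff_fin.2 ⟨0, Fin.elim0, fun i => i.elim0, _,
    hX.preimage_comp Sum.inl, ?_⟩
  intro r _ x
  rfl

theorem DefinableOver.exists_of_finite [Finite β] {X : Set (α ⊕ β → M)}
    (hX : DefinableOver A X) : DefinableOver A {x : α → M | ∃ y : β → M, Sum.elim x y ∈ X} := by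
  obtain ⟨m, e, he, P, hP, rfl⟩ := hX.exists_form
  have h := (hP.preimage_comp (Sum.elim (Sum.map Sum.inl id) (fun p => Sum.inl (Sum.inr p)) :
      _ → (α ⊕ Σ i, Fin (e i).arity) ⊕ β)).exists_of_finite
  refine Eq.mp ?_ (definableOver_of_exists e he h)
  congr 1
  ext x
  have key : ∀ (y : β → M) (r : (Σ i, Fin (e i).arity) → M),
      Sum.elim (Sum.elim x r) y ∘ Sum.elim (Sum.map Sum.inl id) (fun p => Sum.inl (Sum.inr p))
        = Sum.elim (Sum.elim x y) r := fun y r => by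
    funext i
    rcases i with (i | i) | i <;> rfl
  constructor
  · rintro ⟨r, hr, y, hy⟩
    exact ⟨y, r, hr, Set.mem_of_eq_of_mem (key y r).symm hy⟩
  · rintro ⟨y, r, hr, hy⟩
    refine ⟨r, hr, y, ?_⟩
    change _ ∘ _ ∈ P
    exact Set.mem_of_eq_of_mem (key y r) hy

theorem DefinableOver.apply_iff {X : Set (α → M)} (hX : DefinableOver A X) {σ : M ≃[L] M}
    (hσ : Fixes σ A) (x : α → M) : σ ∘ x ∈ X ↔ x ∈ X := by
  obtain ⟨m, e, he, P, hP, h⟩ := definableOver_iff_fin.1 hX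
  obtain ⟨r, hr⟩ := exists_represents e
  rw [h r hr x, h (σ ∘ r) (hr.comp fun i => hσ _ (he i)) (σ ∘ x), ← Sum.comp_elim,
    definable_apply_iff hP σ (by simp)]

/-- Choosing representatives for all of `A` turns parameters from `A` into home-sort parameters, to
which saturation of `M` applies. -/
theorem DefinableOver.definable {X : Set (α → M)} (hX : DefinableOver A X)
    (r : (Σ e : A, Fin e.1.arity) → M) (hr : Represents (fun e : A => e.1) r) :
    (Set.range r).Definable L X := by
  obtain ⟨m, e, he, P, hP, h⟩ := definableOver_iff_fin.1 hX
  have hr' : Represents e (fun p => r ⟨⟨e p.1, he p.1⟩, p.2⟩) := fun i => hr ⟨e i, he i⟩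
  refine Eq.mp ?_ ((definable_fiber hP (fun p => r ⟨⟨e p.1, he p.1⟩, p.2⟩)).mono
    (B := Set.range r) ?_)
  · congr 1
    ext x
    exact (h _ hr' x).symm
  · rintro _ (h | ⟨p, rfl⟩)
    · exact h.elim
    · exact ⟨_, rfl⟩

theorem DefinableOver.definable_univ {X : Set (α → M)} (hX : DefinableOver A X) :
    (Set.univ : Set M).Definable L X := by
  obtain ⟨r, hr⟩ := exists_represents (fun e : A => e.1)
  exact (hX.definable r hr).mono (Set.subset_univ _)

theorem DefinableOver.definable_of_home {S : Set M} {X : Set (α → M)}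
    (hX : DefinableOver (home L '' S) X) : S.Definable L X := by
  choose g hgS hg using fun e : home L '' S => e.2
  let r : (Σ e : home L '' S, Fin e.1.arity) → M := fun p => g p.1
  refine (hX.definable r ?_).mono ?_
  · rintro ⟨e, x, hx, rfl⟩
    rw [mem_cls_iff]
    refine congrArg (Quotient.mk _) (funext fun j => ?_)
    exact home_injective (hg ⟨_, x, hx, rfl⟩)
  · rintro _ ⟨p, rfl⟩
    exact hgS p.1

end DefinableOver

namespace IsMonster

variable {κ : Cardinal.{w}} {A : Set (Imaginary L M)}

/-! ### Saturation and homogeneity over imaginaries -/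

theorem mk_union_lt (hM : IsMonster L M κ) {X : Type w} {S T : Set X} (hS : #S < κ)
    (hT : #T < κ) : #(S ∪ T : Set X) < κ :=
  (mk_union_le S T).trans_lt (add_lt_of_lt hM.infinite hS hT)

theorem mk_lt_of_finite (hM : IsMonster L M κ) {X : Type w} {S : Set X} (hS : S.Finite) :
    #S < κ :=
  hS.lt_aleph0.trans_le hM.infinite

theorem mk_representatives_lt (hM : IsMonster L M κ) (hA : #A < κ) :
    #(Σ e : A, Fin e.1.arity) < κ := by
  rcases finite_or_infinite A with h | h
  · exact (lt_aleph0_of_finite _).trans_le hM.infinite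
  · refine lt_of_le_of_lt ?_ hA
    have hinj : Function.Injective
        (fun p : Σ e : A, Fin e.1.arity => ((p.1, (p.2 : ℕ)) : A × ℕ)) := by
      rintro ⟨e, i⟩ ⟨f, j⟩ h
      obtain ⟨rfl, h'⟩ := Prod.mk.inj h
      exact congrArg (Sigma.mk e) (Fin.ext h')
    refine (mk_le_of_injective hinj).trans ?_
    rw [mk_prod, lift_uzero, mk_nat, lift_aleph0]
    exact (mul_aleph0_eq (aleph0_le_mk A)).le

/-- Homogeneity concerns the home sort only. So fix a tuple `r` representing all of `A`, and find by
saturation another tuple `r'` representing `A` such that `(x, r)` and `(y, r')` have the same type.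
An automorphism carrying one to the other preserves every class in `A`. -/
theorem exists_fixes_of_sameTypeOver (hM : IsMonster L M κ) (hA : #A < κ) [Finite α]
    {x y : α → M} (h : SameTypeOver A x y) : ∃ σ : M ≃[L] M, Fixes σ A ∧ σ ∘ x = y := by
  classical
  obtain ⟨r, hr⟩ := exists_represents (fun e : A => e.1)
  have hR := hM.mk_representatives_lt hA
  have hrange : #(Set.range r) < κ := mk_range_le.trans_lt hR
  let T : Set (α ⊕ (Σ e : A, Fin e.1.arity) → M) → Finset A →
      Set ((Σ e : A, Fin e.1.arity) → M) := fun P E =>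
    {r' | Sum.elim y r' ∈ P} ∩ ⋂ e ∈ E, {r' | (fun j => r' ⟨e, j⟩) ∈ e.1.cls}
  have hne : (⋂₀ {t | ∃ P E, (∅ : Set M).Definable L P ∧ Sum.elim x r ∈ P ∧
      t = T P E}).Nonempty := by
    refine hM.sInter_nonempty (A := Set.range y ∪ Set.range r)
      (hM.mk_union_lt (hM.mk_lt_of_finite (Set.finite_range y)) hrange) hR _ ?_ ?_ ?_ ?_
    · rintro _ ⟨P, E, hP, -, rfl⟩
      refine Set.Definable.inter ?_ (Set.definable_biInter_finset (fun e => ?_) E)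
      · refine Eq.mp ?_ ((definable_fiber (hP.preimage_comp Sum.swap) y).mono
          (B := Set.range y ∪ Set.range r) (by simp))
        congr 1
        ext r'
        refine iff_of_eq (congrArg (· ∈ P) ?_)
        exact Sum.elim_swap ..
      · have h₁ := (definable_fiber e.1.1.definable (fun j => r ⟨e, j⟩)).preimage_comp
          ((fun j => ⟨e, j⟩) : Fin e.1.arity → Σ e : A, Fin e.1.arity)
        refine Eq.mp ?_ (h₁.mono (B := Set.range y ∪ Set.range r) ?_)
        · congr 1
          ext r'
          exact rel_iff_of_mem_cls (hr e)
        · rintro _ (h | ⟨j, rfl⟩)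
          · exact h.elim
          · exact Or.inr ⟨_, rfl⟩
    · exact ⟨_, Set.univ, ∅, Set.definable_univ, trivial, rfl⟩
    · rintro _ ⟨P, E, hP, hx, rfl⟩ _ ⟨P', E', hP', hx', rfl⟩
      refine ⟨P ∩ P', E ∪ E', hP.inter hP', ⟨hx, hx'⟩, ?_⟩
      ext r'
      simp only [T, Set.mem_inter_iff, Set.mem_iInter, Finset.mem_union, Set.mem_ofPred_eq]
      grind
    · rintro _ ⟨P, E, hP, hx, rfl⟩
      -- Finite satisfiability: `P` sees the coordinates of finitely many imaginaries, so "some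
      -- representatives satisfy `P`" defines a set over `A`. It contains `x`, hence `y`.
      obtain ⟨t, P₀, hP₀, rfl⟩ := exists_finite_support hP
      let E' : Finset A := E ∪ t.toRight.image Sigma.fst
      have ht : ∀ e j, Sum.inr ⟨e, j⟩ ∈ t → e ∈ E' := fun e j h => Finset.mem_union_right _
        (Finset.mem_image.2 ⟨⟨e, j⟩, Finset.mem_toRight.2 h, rfl⟩)
      let f : t → α ⊕ (Σ e : E', Fin e.1.1.arity) := fun i => match i with
        | ⟨Sum.inl a, _⟩ => Sum.inl a
        | ⟨Sum.inr ⟨e, j⟩, h⟩ => Sum.inr ⟨⟨e, ht e j h⟩, j⟩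
      have hQ := definableOver_of_exists (A := A) (fun e : E' => e.1.1) (fun e => e.1.2)
        (hP₀.preimage_comp f)
      have hxQ := (h _ hQ).1 ⟨fun p => r ⟨p.1.1, p.2⟩, fun e => hr e.1, by
        change _ ∘ _ ∈ P₀
        refine Set.mem_of_eq_of_mem (funext fun i => ?_) hx
        rcases i with ⟨i | ⟨e, j⟩, hi⟩ <;> rfl⟩
      obtain ⟨r₀, hr₀, hy⟩ := hxQ
      -- Coordinates outside `E'` are unconstrained; `r` merely fills them.
      let r' : (Σ e : A, Fin e.1.arity) → M := fun p =>
        if h : p.1 ∈ E' then r₀ ⟨⟨p.1, h⟩, p.2⟩ else r p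
      have hr'E : ∀ e (h : e ∈ E') j, r' ⟨e, j⟩ = r₀ ⟨⟨e, h⟩, j⟩ := fun e h j => dif_pos h
      refine ⟨r', ?_, ?_⟩
      · change _ ∘ _ ∈ P₀
        refine Set.mem_of_eq_of_mem (funext fun i => ?_) hy
        rcases i with ⟨i | ⟨e, j⟩, hi⟩
        · rfl
        · exact hr'E _ _ _
      · simp only [Set.mem_iInter]
        intro e he
        have he' : e ∈ E' := Finset.mem_union_left _ he
        change (fun j => r' ⟨e, j⟩) ∈ e.1.cls
        exact Set.mem_of_eq_of_mem (funext fun j => hr'E e he' j) (hr₀ ⟨e, he'⟩)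
  obtain ⟨r', hr'⟩ := hne
  have hst : SameType L (Sum.elim x r) (Sum.elim y r') := sameType_of_forall fun P hP hx =>
    (hr' _ ⟨P, ∅, hP, hx, rfl⟩).1
  obtain ⟨σ, hσ⟩ := hM.exists_equiv_of_sameType (by
    rw [Set.Sum.elim_range]
    exact hM.mk_union_lt (hM.mk_lt_of_finite (Set.finite_range x)) hrange) hst
  refine ⟨σ, fun e he => ?_, funext fun i => congrFun hσ (Sum.inl i)⟩
  rw [act_eq_iff (hr ⟨e, he⟩) σ]
  have h₁ := (hr' _ ⟨Set.univ, {⟨e, he⟩}, Set.definable_univ, trivial, rfl⟩).2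
  simp only [Finset.mem_singleton, Set.iInter_iInter_eq_left] at h₁
  exact Set.mem_of_eq_of_mem (funext fun j => congrFun hσ (Sum.inr ⟨_, j⟩)) h₁

/-- A definable set invariant under the automorphisms which fix `A` and the tuple `x` is the
fibre at `x` of a set definable over `A`. -/
theorem exists_definableOver_fiber (hM : IsMonster L M κ) (hA : #A < κ) [Finite α] [Finite β]
    {Y : Set (β → M)} (hY : (Set.univ : Set M).Definable L Y) (x : α → M)
    (hinv : ∀ σ : M ≃[L] M, Fixes σ A → σ ∘ x = x → ∀ z ∈ Y, σ ∘ z ∈ Y) :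
    ∃ Z : Set (α ⊕ β → M), DefinableOver A Z ∧ ∀ z, z ∈ Y ↔ Sum.elim x z ∈ Z := by
  obtain ⟨k, m, P, hP, rfl⟩ := exists_fin_params hY
  -- A point of `T Q` is a pair `(m', z)` such that `(x, m') ∈ Q` and `z` lies in exactly one of the
  -- sets defined by `P` with parameters `m'` and `m`.
  let T : Set (α ⊕ Fin k → M) → Set (Fin k ⊕ β → M) := fun Q =>
    {w | Sum.elim x (w ∘ Sum.inl) ∈ Q} ∩
      {w | ¬ (Sum.elim (w ∘ Sum.inr) (w ∘ Sum.inl) ∈ P ↔ Sum.elim (w ∘ Sum.inr) m ∈ P)}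
  -- By compactness some condition `Q` on `(x, m)` over `A` forces every `m'` satisfying it to
  -- define `Y`. Otherwise saturation yields `m'` with the type of `m` over `A` and `x` that defines
  -- a different set, and an automorphism taking `m` to `m'` violates the invariance of `Y`.
  have key : ∃ Q, DefinableOver A Q ∧ Sum.elim x m ∈ Q ∧ ¬ (T Q).Nonempty := by
    by_contra! hcon
    obtain ⟨r, hr⟩ := exists_represents (fun e : A => e.1)
    let S : Set M := Set.range r ∪ (Set.range x ∪ Set.range m)
    have hS : #S < κ := hM.mk_union_lt (mk_range_le.trans_lt (hM.mk_representatives_lt hA))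
      (hM.mk_lt_of_finite ((Set.finite_range x).union (Set.finite_range m)))
    have hne : (⋂₀ {t | ∃ Q, DefinableOver A Q ∧ Sum.elim x m ∈ Q ∧ t = T Q}).Nonempty := by
      refine hM.sInter_nonempty_of_finite hS _ ?_ ?_ ?_ ?_
      · rintro _ ⟨Q, hQ, -, rfl⟩
        have h₁ : S.Definable L {w : Fin k ⊕ β → M | Sum.elim x (w ∘ Sum.inl) ∈ Q} := by
          refine Eq.mp ?_ (((definable_fiber ((hQ.definable r hr).preimage_comp Sum.swap)
            x).mono (B := S) ?_).preimage_comp (Sum.inl : Fin k → Fin k ⊕ β))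
          · congr 1
            ext w
            refine iff_of_eq (congrArg (· ∈ Q) ?_)
            exact Sum.elim_swap ..
          · exact Set.union_subset_union_right _ Set.subset_union_left
        have h₂ : S.Definable L {w : Fin k ⊕ β → M |
            Sum.elim (w ∘ Sum.inr) (w ∘ Sum.inl) ∈ P} := by
          refine Eq.mp ?_ ((hP.mono (Set.empty_subset S)).preimage_comp
            (Sum.elim Sum.inr Sum.inl : _ → Fin k ⊕ β))
          congr 1
          ext w
          exact iff_of_eq (congrArg (· ∈ P) (Sum.comp_elim ..))
        have h₃ : S.Definable L {w : Fin k ⊕ β → M | Sum.elim (w ∘ Sum.inr) m ∈ P} :=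
          ((definable_fiber hP m).mono (B := S) (Set.empty_union _ ▸
            Set.subset_union_right.trans Set.subset_union_right)).preimage_comp Sum.inr
        refine h₁.inter ?_
        convert! (h₂.sdiff h₃).union (h₃.sdiff h₂) using 1
        ext w
        simp only [Set.mem_ofPred_eq, Set.mem_union, Set.mem_sdiff]
        tauto
      · exact ⟨_, Set.univ, definableOver_of_definable Set.definable_univ, trivial, rfl⟩
      · rintro _ ⟨Q, hQ, hx, rfl⟩ _ ⟨Q', hQ', hx', rfl⟩
        refine ⟨Q ∩ Q', hQ.inter hQ', ⟨hx, hx'⟩, ?_⟩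
        ext w
        simp only [T, Set.mem_inter_iff, Set.mem_ofPred_eq]
        tauto
      · rintro _ ⟨Q, hQ, hx, rfl⟩
        exact hcon Q hQ hx
    obtain ⟨w, hw⟩ := hne
    have hst : SameTypeOver A (Sum.elim x m) (Sum.elim x (w ∘ Sum.inl)) := fun Q hQ =>
      ⟨fun h => (hw _ ⟨Q, hQ, h, rfl⟩).1, fun h => by
        by_contra h'
        exact (hw _ ⟨_, hQ.compl, h', rfl⟩).1 h⟩
    obtain ⟨σ, hσA, hσ⟩ := hM.exists_fixes_of_sameTypeOver hA hst
    have hσx : σ ∘ x = x := funext fun i => congrFun hσ (Sum.inl i)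
    have hσm : σ ∘ m = w ∘ Sum.inl := funext fun i => congrFun hσ (Sum.inr i)
    have hσx' : σ.symm ∘ x = x := by
      conv_lhs => rw [← hσx]
      exact symm_comp_tuple σ x
    refine (hw _ ⟨Set.univ, definableOver_of_definable Set.definable_univ, trivial, rfl⟩).2 ?_
    have hP' : ∀ z, Sum.elim (σ ∘ z) (w ∘ Sum.inl) ∈ P ↔ Sum.elim z m ∈ P := fun z => by
      rw [← hσm, ← Sum.comp_elim]
      exact definable_apply_iff hP σ (by simp) _
    rw [← comp_symm_tuple σ (w ∘ Sum.inr), hP']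
    constructor
    · exact fun h => hinv σ hσA hσx _ h
    · intro h
      have := hinv σ.symm hσA.symm hσx' _ h
      rwa [symm_comp_tuple] at this
  obtain ⟨Q, hQ, hxm, hT⟩ := key
  have hT' : ∀ m' z, Sum.elim x m' ∈ Q → (Sum.elim z m' ∈ P ↔ Sum.elim z m ∈ P) := by
    intro m' z h
    by_contra h'
    exact hT ⟨Sum.elim m' z, h, h'⟩
  have h₁ := hQ.preimage_comp
    (Sum.elim (fun a => Sum.inl (Sum.inl a)) Sum.inr : _ → (α ⊕ β) ⊕ Fin k)
  have h₂ := (definableOver_of_definable (A := A) hP).preimage_comp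
    (Sum.elim (fun a => Sum.inl (Sum.inr a)) Sum.inr : _ → (α ⊕ β) ⊕ Fin k)
  refine ⟨_, (h₁.inter h₂).exists_of_finite, fun z => ?_⟩
  have e₁ : ∀ m', Sum.elim (Sum.elim x z) m' ∘
      (Sum.elim (fun a => Sum.inl (Sum.inl a)) Sum.inr : _ → (α ⊕ β) ⊕ Fin k)
      = Sum.elim x m' := fun m' => by
    funext i
    rcases i with i | i <;> rfl
  have e₂ : ∀ m', Sum.elim (Sum.elim x z) m' ∘
      (Sum.elim (fun a => Sum.inl (Sum.inr a)) Sum.inr : _ → (α ⊕ β) ⊕ Fin k)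
      = Sum.elim z m' := fun m' => by
    funext i
    rcases i with i | i <;> rfl
  simp only [Set.mem_ofPred_eq, Set.mem_inter_iff, Set.mem_preimage, e₁, e₂]
  exact ⟨fun h => ⟨m, hxm, h⟩, fun ⟨m', h, h'⟩ => (hT' m' z h).1 h'⟩

end IsMonster

/-! ### Orbits of imaginaries -/

section Orbits

variable {A B : Set (Imaginary L M)} {e d : Imaginary L M}

/-- The orbit of the imaginary `e` under the automorphisms which fix `A`. -/
def imOrbit (A : Set (Imaginary L M)) (e : Imaginary L M) : Set (Imaginary L M) :=
  {f | ∃ σ : M ≃[L] M, Fixes σ A ∧ act σ e = f}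

theorem mem_imOrbit_self : e ∈ imOrbit A e := ⟨_, Fixes.refl, act_refl e⟩

theorem imOrbit_anti (h : A ⊆ B) : imOrbit B e ⊆ imOrbit A e :=
  fun _ ⟨σ, hσ, hf⟩ => ⟨σ, hσ.mono h, hf⟩

theorem act_mem_imOrbit {f : Imaginary L M} (hf : f ∈ imOrbit A e) {σ : M ≃[L] M}
    (hσ : Fixes σ A) : act σ f ∈ imOrbit A e := by
  obtain ⟨τ, hτ, rfl⟩ := hf
  exact ⟨σ.comp τ, hσ.comp hτ, act_comp σ τ e⟩

theorem imOrbit_finite_of_fixed (h : ∀ σ : M ≃[L] M, Fixes σ A → act σ e = e) :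
    (imOrbit A e).Finite :=
  (Set.finite_singleton e).subset fun _ ⟨σ, hσ, hf⟩ => hf.symm.trans (h σ hσ)

theorem imOrbit_finite_of_mem (h : e ∈ A) : (imOrbit A e).Finite :=
  imOrbit_finite_of_fixed fun _ hσ => hσ e h

/-- Transitivity of algebraicity. For each conjugate `f` of `d` fix some `τ f` carrying `d` to it;
every conjugate of `e` is then the image under some `τ f` of a conjugate of `e` over `A` and `d`. -/
theorem imOrbit_finite_of_insert (hd : (imOrbit A d).Finite)
    (he : (imOrbit (insert d A) e).Finite) : (imOrbit A e).Finite := by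
  choose τ hτ hτd using fun f : imOrbit A d => f.2
  have := hd.to_subtype
  refine (Set.finite_iUnion fun f : imOrbit A d => he.image (act (τ f))).subset ?_
  rintro _ ⟨σ, hσ, rfl⟩
  let f : imOrbit A d := ⟨act σ d, σ, hσ, rfl⟩
  refine Set.mem_iUnion.2 ⟨f, _, ⟨(τ f).symm.comp σ, ?_, rfl⟩, ?_⟩
  · refine ((hτ f).symm.comp hσ).insert ?_
    rw [act_comp, show act σ d = act (τ f) d from (hτd f).symm, act_symm_act]
  · rw [act_comp, act_act_symm]

theorem imOrbit_finite_of_union {S : Set (Imaginary L M)} (hS : S.Finite)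
    (h : ∀ d ∈ S, (imOrbit A d).Finite) (he : (imOrbit (A ∪ S) e).Finite) :
    (imOrbit A e).Finite := by
  induction S, hS using Set.Finite.induction_on with
  | empty => simpa using he
  | @insert d S _ _ ih =>
    refine ih (fun f hf => h f (Set.mem_insert_of_mem d hf)) ?_
    rw [Set.union_insert] at he
    exact imOrbit_finite_of_insert
      ((h d (Set.mem_insert d S)).subset (imOrbit_anti Set.subset_union_left)) he

theorem definable_reps_of_finite (s : ImSort L M) {F : Set (Quotient s.rel)} (hF : F.Finite)
    {A : Set M} (hA : ∀ q ∈ F, ∃ r, Quotient.mk s.rel r = q ∧ Set.range r ⊆ A) :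
    A.Definable L {r | Quotient.mk s.rel r ∈ F} := by
  induction F, hF using Set.Finite.induction_on with
  | empty => exact Set.definable_empty
  | @insert q F _ _ ih =>
    obtain ⟨r, hr, hrA⟩ := hA q (Set.mem_insert q F)
    exact (cls_definable_of_mem (e := ⟨s, q⟩) hr hrA).union
      (ih fun p hp => hA p (Set.mem_insert_of_mem q hp))

theorem definable_univ_reps_of_finite (s : ImSort L M) {F : Set (Quotient s.rel)}
    (hF : F.Finite) : (Set.univ : Set M).Definable L {r | Quotient.mk s.rel r ∈ F} :=
  definable_reps_of_finite s hF fun q _ =>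
    (Quotient.exists_rep q).imp fun _ h => ⟨h, Set.subset_univ _⟩

theorem finite_setOf_mk_mem (s : ImSort L M) {O : Set (Imaginary L M)} (hO : O.Finite) :
    {q : Quotient s.rel | (⟨s, q⟩ : Imaginary L M) ∈ O}.Finite :=
  hO.preimage sigma_mk_injective.injOn

theorem sameTypeOver_of_fixes {x : α → M} {σ : M ≃[L] M} (hσ : Fixes σ A) :
    SameTypeOver A x (σ ∘ x) := fun _ hX => (hX.apply_iff hσ x).symm

end Orbits

/-! ### Definability and closures over imaginaries in terms of orbits -/

namespace IsMonster

variable {κ : Cardinal.{w}} {A : Set (Imaginary L M)} {e : Imaginary L M}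

/-- The case of an empty tuple in `exists_definableOver_fiber`. -/
theorem definableOver_of_invariant (hM : IsMonster L M κ) (hA : #A < κ) [Finite β]
    {Y : Set (β → M)} (hY : (Set.univ : Set M).Definable L Y)
    (hinv : ∀ σ : M ≃[L] M, Fixes σ A → ∀ z ∈ Y, σ ∘ z ∈ Y) : DefinableOver A Y := by
  obtain ⟨Z, hZ, h⟩ := hM.exists_definableOver_fiber hA hY (Fin.elim0 : Fin 0 → M)
    (fun σ hσ _ => hinv σ hσ)
  refine Eq.mp ?_ (hZ.preimage_comp (Sum.elim (fun i => i.elim0) id : _ → β))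
  congr 1
  ext z
  rw [h z]
  refine iff_of_eq (congrArg (· ∈ Z) (funext fun i => ?_))
  rcases i with i | i
  · exact i.elim0
  · rfl

theorem mem_aclEq_iff (hM : IsMonster L M κ) (hA : #A < κ) :
    e ∈ aclEq A ↔ (imOrbit A e).Finite := by
  constructor
  · rintro ⟨F, hF, heF, hX⟩
    refine (hF.image (Sigma.mk e.1)).subset ?_
    rintro _ ⟨σ, hσ, rfl⟩
    obtain ⟨r, hr⟩ := exists_mem_cls e
    rw [act_of_mem_cls hr]
    refine ⟨_, (hX.apply_iff hσ r).2 ?_, rfl⟩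
    rwa [Set.mem_ofPred_eq, mem_cls_iff.1 hr]
  · intro h
    refine ⟨_, finite_setOf_mk_mem e.1 h, mem_imOrbit_self, hM.definableOver_of_invariant hA
      (definable_univ_reps_of_finite e.1 (finite_setOf_mk_mem e.1 h)) fun σ hσ r hr => ?_⟩
    exact act_mem_imOrbit hr hσ

theorem mem_dclEq_iff (hM : IsMonster L M κ) (hA : #A < κ) :
    e ∈ dclEq A ↔ ∀ σ : M ≃[L] M, Fixes σ A → act σ e = e := by
  constructor
  · intro h σ hσ
    obtain ⟨r, hr⟩ := exists_mem_cls e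
    exact (act_eq_iff hr σ).2 ((DefinableOver.apply_iff h hσ r).2 hr)
  · intro h
    exact hM.definableOver_of_invariant hA (cls_definable e) fun σ hσ r hr =>
      (act_eq_iff hr σ).1 (h σ hσ)

end IsMonster

/-! ### Relative isolation by orbits -/

/-- `tp(x/A)` is relatively isolated, with entailment and definability over `A` expressed by
automorphisms which fix `A`. -/
def OrbitIsolated (A : Set (Imaginary L M)) (x : α → M) : Prop :=
  ∃ X : Set (α → M), (Set.univ : Set M).Definable L X ∧
    (∀ σ : M ≃[L] M, Fixes σ A → ∀ z ∈ X, σ ∘ z ∈ X) ∧ x ∈ X ∧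
    ∀ y, SameType L x y → y ∈ X → ∃ σ : M ≃[L] M, Fixes σ A ∧ σ ∘ x = y

namespace OrbitIsolated

variable {A B : Set (Imaginary L M)} {x : α → M} {y : β → M}

/-- The base enters only through its pointwise stabilizer, so interdefinable bases may be exchanged.
-/
theorem congr (h : OrbitIsolated A x) (hAB : ∀ σ : M ≃[L] M, Fixes σ A ↔ Fixes σ B) :
    OrbitIsolated B x := by
  simpa only [OrbitIsolated, hAB] using h

/-- Equalities between coordinates belong to the type over `∅`, so neither order nor repetition in
the enumeration matters. -/
theorem of_range_eq (h : OrbitIsolated A x) (hxy : Set.range x = Set.range y) :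
    OrbitIsolated A y := by
  obtain ⟨X, hX, hinv, hxX, hiso⟩ := h
  have hf : ∀ j, ∃ i, x i = y j := fun j => hxy.symm.subset ⟨j, rfl⟩
  have hg : ∀ i, ∃ j, y j = x i := fun i => hxy.subset ⟨i, rfl⟩
  choose f hf using hf
  choose g hg using hg
  obtain rfl : y ∘ g = x := funext hg
  refine ⟨_, hX.preimage_comp g, fun σ hσ z hz => hinv σ hσ _ hz, hxX, fun z hz hzX => ?_⟩
  obtain ⟨σ, hσ, hσz⟩ := hiso (z ∘ g) (hz.comp g) hzX
  refine ⟨σ, hσ, funext fun j => ?_⟩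
  have h₁ : σ (y (g (f j))) = z (g (f j)) := congrFun hσz (f j)
  rw [show z j = z (g (f j)) from (hz.apply_eq (hf j)).symm, ← h₁]
  exact congrArg σ (hf j).symm

/-- The orbit of `x` is finite, hence definable, and is itself the isolating set. -/
theorem of_finite_imOrbit [Finite α] (h : ∀ i, (imOrbit A (home L (x i))).Finite) :
    OrbitIsolated A x := by
  have hfin : {z : α → M | ∃ σ : M ≃[L] M, Fixes σ A ∧ σ ∘ x = z}.Finite := by
    refine (Set.Finite.pi' fun i => (h i).preimage home_injective.injOn).subset ?_
    rintro _ ⟨σ, hσ, rfl⟩ i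
    exact ⟨σ, hσ, act_home σ (x i)⟩
  refine ⟨_, definable_of_finite hfin, ?_, ⟨_, Fixes.refl, rfl⟩, fun y _ hy => hy⟩
  rintro σ hσ _ ⟨τ, hτ, rfl⟩
  exact ⟨σ.comp τ, hσ.comp hτ, rfl⟩

end OrbitIsolated

/-! ### Relative isolation: transitivity and algebraic extension of the base -/

namespace IsMonster

variable {κ : Cardinal.{w}} {A : Set (Imaginary L M)} {x : α → M} {y : β → M}

theorem relIsolated_iff (hM : IsMonster L M κ) (hA : #A < κ) [Finite α] :
    RelIsolated A x ↔ OrbitIsolated A x := by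
  constructor
  · rintro ⟨X, hX, hxX, hiso⟩
    exact ⟨X, hX.definable_univ, fun σ hσ z hz => (hX.apply_iff hσ z).2 hz, hxX,
      fun y hy hyX => hM.exists_fixes_of_sameTypeOver hA (hiso y hy hyX)⟩
  · rintro ⟨X, hX, hinv, hxX, hiso⟩
    refine ⟨X, hM.definableOver_of_invariant hA hX hinv, hxX, fun y hy hyX => ?_⟩
    obtain ⟨σ, hσ, rfl⟩ := hiso y hy hyX
    exact sameTypeOver_of_fixes hσ

/-- Transitivity: the isolating set of `x` over `A` and `y` is the fibre at `y` of a set `Z` over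
`A`. Given a competitor `w` in the intersection, pull its first half back to `y` by an automorphism
over `A`, then match the second halves over `A` and `y`. -/
theorem orbitIsolated_elim (hM : IsMonster L M κ) (hA : #A < κ) [Finite α] [Finite β]
    (hy : OrbitIsolated A y) (hx : OrbitIsolated (A ∪ home L '' Set.range y) x) :
    OrbitIsolated A (Sum.elim y x) := by
  obtain ⟨Y, hY, hYinv, hyY, hYiso⟩ := hy
  obtain ⟨X, hX, hXinv, hxX, hXiso⟩ := hx
  obtain ⟨Z, hZ, hXZ⟩ := hM.exists_definableOver_fiber hA hX y fun σ hσ hσy z hz =>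
    hXinv σ (hσ.union (fixes_home_range_iff.2 hσy)) z hz
  refine ⟨_, (hY.preimage_comp Sum.inl).inter hZ.definable_univ,
    fun σ hσ z hz => ⟨hYinv σ hσ _ hz.1, (hZ.apply_iff hσ z).2 hz.2⟩,
    ⟨hyY, (hXZ x).1 hxX⟩, fun w hw hwZ => ?_⟩
  obtain ⟨σ, hσ, hσy⟩ := hYiso (w ∘ Sum.inl) (hw.comp Sum.inl) hwZ.1
  have hw' : Sum.elim y (σ.symm ∘ w ∘ Sum.inr) = σ.symm ∘ w := by
    funext i
    rcases i with i | i
    · exact (σ.symm_apply_apply (y i)).symm.trans (congrArg σ.symm (congrFun hσy i))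
    · rfl
  obtain ⟨τ, hτ, hτx⟩ := hXiso (σ.symm ∘ w ∘ Sum.inr)
    ((hw.comp Sum.inr).trans (sameType_comp _ _)) (by
      rw [hXZ, hw', hZ.apply_iff hσ.symm]
      exact hwZ.2)
  have hτy := fixes_home_range_iff.1 (hτ.mono Set.subset_union_right)
  refine ⟨σ.comp τ, hσ.comp (hτ.mono Set.subset_union_left), funext fun i => ?_⟩
  rcases i with i | i
  · exact (congrArg σ (congrFun hτy i)).trans (congrFun hσy i)
  · exact (congrArg σ (congrFun hτx i)).trans (σ.apply_symm_apply _)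

theorem orbitIsolated_of_range_eq_union (hM : IsMonster L M κ) (hA : #A < κ) [Finite α]
    [Finite β] {z : γ → M} (hy : OrbitIsolated A y)
    (hx : OrbitIsolated (A ∪ home L '' Set.range y) x)
    (hz : Set.range z = Set.range y ∪ Set.range x) : OrbitIsolated A z :=
  (hM.orbitIsolated_elim hA hy hx).of_range_eq (by rw [Set.Sum.elim_range, hz])

/-- The isolating condition on `z` gains the clause that `d` lies in the fibre at `z` of a set `Z`
over `A`, whose fibre at `x` is the finite orbit of `d` over `A` and `x`. If `σ` carries `x` to such
a `z`, then the preimage of `d` under `σ` is conjugate to `d` over `A` and `x`, so `σ` can be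
corrected to fix `d`. -/
theorem orbitIsolated_insert (hM : IsMonster L M κ) (hA : #A < κ) [Finite α]
    (hx : OrbitIsolated A x) {d : Imaginary L M} (hd : (imOrbit A d).Finite) :
    OrbitIsolated (insert d A) x := by
  obtain ⟨X, hX, hXinv, hxX, hXiso⟩ := hx
  have hO : (imOrbit (A ∪ home L '' Set.range x) d).Finite :=
    hd.subset (imOrbit_anti Set.subset_union_left)
  obtain ⟨Z, hZ, hOZ⟩ := hM.exists_definableOver_fiber hA
    (definable_univ_reps_of_finite d.1 (finite_setOf_mk_mem d.1 hO)) x fun σ hσ hσx r hr =>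
      act_mem_imOrbit hr (hσ.union (fixes_home_range_iff.2 hσx))
  refine ⟨_, hX.inter (hZ.definable_univ.inter
    ((cls_definable d).preimage_comp Sum.inr)).exists_of_finite, ?_, ⟨hxX, ?_⟩, ?_⟩
  · rintro σ hσ z ⟨hz, r, hr, hrd⟩
    have hσA := hσ.mono (Set.subset_insert d A)
    refine ⟨hXinv σ hσA z hz, σ ∘ r, ?_, (act_eq_iff hrd σ).1 (hσ d (Set.mem_insert d A))⟩
    rw [← Sum.comp_elim]
    exact (hZ.apply_iff hσA _).2 hr
  · obtain ⟨r, hr⟩ := exists_mem_cls d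
    refine ⟨r, (hOZ r).1 ?_, hr⟩
    change (⟨d.1, Quotient.mk d.1.rel r⟩ : Imaginary L M) ∈
      imOrbit (A ∪ home L '' Set.range x) d
    rw [mem_cls_iff.1 hr]
    exact mem_imOrbit_self
  · rintro z hz ⟨hzX, r, hr, hrd⟩
    obtain ⟨σ, hσ, rfl⟩ := hXiso z hz hzX
    have h₁ : Sum.elim x (σ.symm ∘ r) ∈ Z := by
      rw [← hZ.apply_iff hσ, Sum.comp_elim, comp_symm_tuple]
      exact hr
    obtain ⟨τ, hτ, hτd⟩ := (hOZ _).2 h₁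
    have hτx := fixes_home_range_iff.1 (hτ.mono Set.subset_union_right)
    refine ⟨σ.comp τ, (hσ.comp (hτ.mono Set.subset_union_left)).insert ?_, ?_⟩
    · rw [act_comp, hτd, act_mk, comp_symm_tuple]
      exact Sigma.ext rfl (heq_of_eq hrd)
    · change σ ∘ (τ ∘ x) = _
      rw [hτx]

theorem orbitIsolated_union (hM : IsMonster L M κ) (hA : #A < κ) [Finite α]
    (hx : OrbitIsolated A x) {S : Set (Imaginary L M)} (hS : S.Finite)
    (h : ∀ d ∈ S, (imOrbit A d).Finite) : OrbitIsolated (A ∪ S) x := by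
  induction S, hS using Set.Finite.induction_on with
  | empty => simpa using hx
  | @insert d S _ hS ih =>
    rw [Set.union_insert]
    exact hM.orbitIsolated_insert (hM.mk_union_lt hA (hM.mk_lt_of_finite hS))
      (ih fun f hf => h f (Set.mem_insert_of_mem d hf))
      ((h d (Set.mem_insert d S)).subset (imOrbit_anti Set.subset_union_left))

end IsMonster

/-! ### Classes of weakly opaque equivalence relations -/

namespace OpaquePresentation

variable {A : Set (Imaginary L M)} {a : Imaginary L M} (W : OpaquePresentation A a)

/-- The imaginary coding the class of `x`. -/
def classOf (x : W.D) : Imaginary L M := ⟨a.1, W.code (Quotient.mk W.E x)⟩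

theorem classOf_b : W.classOf W.b = a := Sigma.ext rfl (heq_of_eq W.code_b)

theorem mk_eq_of_classOf_eq {W : OpaquePresentation A a} {x y : W.D}
    (h : W.classOf x = W.classOf y) :
    Quotient.mk W.E x = Quotient.mk W.E y :=
  W.code_injective (eq_of_heq (Sigma.mk.inj h).2)

theorem act_classOf {σ : M ≃[L] M} (hσ : Fixes σ A) (x : W.D) :
    ∃ hx : σ ∘ x.1 ∈ W.D, act σ (W.classOf x) = W.classOf ⟨σ ∘ x.1, hx⟩ := by
  obtain ⟨r, hr⟩ := exists_mem_cls (W.classOf x)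
  obtain ⟨hx, h⟩ := (W.code_definable.apply_iff hσ (Sum.elim x.1 r)).2 ⟨x.2, hr.symm⟩
  refine ⟨hx, ?_⟩
  rw [act_of_mem_cls hr]
  exact Sigma.ext rfl (heq_of_eq h.symm)

theorem domain_definableOver : DefinableOver A W.D := by
  refine Eq.mp ?_ W.code_definable.exists_of_finite
  congr 1
  ext x
  constructor
  · rintro ⟨r, hx, -⟩
    exact hx
  · intro hx
    obtain ⟨r, hr⟩ := Quotient.exists_rep (W.code (Quotient.mk W.E ⟨x, hx⟩))
    exact ⟨r, hx, hr.symm⟩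

theorem fiber_definable :
    (Set.univ : Set M).Definable L {x | ∃ hx : x ∈ W.D, W.classOf ⟨x, hx⟩ = a} := by
  refine Eq.mp ?_ (W.code_definable.definable_univ.inter
    ((cls_definable a).preimage_comp Sum.inr)).exists_of_finite
  congr 1
  ext x
  constructor
  · rintro ⟨r, ⟨hx, h⟩, hr⟩
    exact ⟨hx, Sigma.ext rfl (heq_of_eq (h.trans hr))⟩
  · rintro ⟨hx, h⟩
    obtain ⟨r, hr⟩ := exists_mem_cls a
    exact ⟨r, ⟨hx, (eq_of_heq (Sigma.mk.inj h).2).trans hr.symm⟩, hr⟩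

theorem act_eq_of_comp_b {σ : M ≃[L] M} (hσ : Fixes σ A) (hb : σ ∘ W.b.1 = W.b.1) :
    act σ a = a := by
  obtain ⟨hx, h⟩ := W.act_classOf hσ W.b
  rw [W.classOf_b] at h
  exact h.trans ((congrArg W.classOf (Subtype.ext hb)).trans W.classOf_b)

/-- If `Z` separated `x` from `y`, each automorphism over `B` would carry this splitting to the
class of a conjugate of `a`. The orbit of `a` over `B` would then consist of codes of split classes,
of which there are finitely many. -/
theorem mem_of_sameType {B : Set (Imaginary L M)} (hAB : A ⊆ B) (ha : ¬ (imOrbit B a).Finite)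
    {x y : W.D} (hx : W.classOf x = a) (hy : W.classOf y = a) (hxy : SameType L x.1 y.1)
    {Z : Set (Fin W.arity → M)} (hZ : DefinableOver B Z) (hxZ : x.1 ∈ Z) : y.1 ∈ Z := by
  by_contra hyZ
  -- Weak opacity speaks of subsets of the domain, which is itself definable over `A`.
  refine ha (((W.opaque_rel (Z ∩ W.D) Set.inter_subset_right
    (hZ.inter (W.domain_definableOver.mono hAB)).definable_univ).image
      (fun q => (⟨a.1, W.code q⟩ : Imaginary L M))).subset ?_)
  rintro _ ⟨σ, hσ, rfl⟩
  obtain ⟨hx', hσx⟩ := W.act_classOf (hσ.mono hAB) x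
  obtain ⟨hy', hσy⟩ := W.act_classOf (hσ.mono hAB) y
  rw [hx] at hσx
  rw [hy] at hσy
  refine ⟨Quotient.mk W.E ⟨_, hx'⟩, ⟨⟨_, hx'⟩, ⟨_, hy'⟩, rfl,
    mk_eq_of_classOf_eq (hσy.symm.trans hσx),
    (sameType_comp σ _).symm.trans (hxy.trans (sameType_comp σ _)),
    ⟨(hZ.apply_iff hσ _).2 hxZ, hx'⟩, fun h => hyZ ((hZ.apply_iff hσ _).1 h.1)⟩, hσx.symm⟩

end OpaquePresentation

/-- The isolating set is the class of `a`. An automorphism over `B` moving `b` within this class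
automatically fixes `a`. -/
theorem IsMonster.orbitIsolated_representative {κ : Cardinal.{w}} (hM : IsMonster L M κ)
    {A B : Set (Imaginary L M)} {a : Imaginary L M} (W : OpaquePresentation A a) (hAB : A ⊆ B)
    (hB : #B < κ) (ha : ¬ (imOrbit B a).Finite) : OrbitIsolated (insert a B) W.b.1 := by
  refine ⟨_, W.fiber_definable, ?_, ⟨W.b.2, W.classOf_b⟩, ?_⟩
  · rintro σ hσ z ⟨hz, hza⟩
    obtain ⟨hz', h⟩ := W.act_classOf (hσ.mono (hAB.trans (Set.subset_insert a B))) ⟨z, hz⟩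
    rw [hza, hσ a (Set.mem_insert a B)] at h
    exact ⟨hz', h.symm⟩
  · rintro y hby ⟨hy, hya⟩
    obtain ⟨σ, hσ, rfl⟩ := hM.exists_fixes_of_sameTypeOver hB (x := W.b.1) (y := y)
      fun Z hZ => ⟨W.mem_of_sameType hAB ha (y := ⟨y, hy⟩) W.classOf_b hya hby hZ,
        W.mem_of_sameType hAB ha (x := ⟨y, hy⟩) hya W.classOf_b hby.symm hZ⟩
    obtain ⟨hx, h⟩ := W.act_classOf (hσ.mono hAB) W.b
    rw [W.classOf_b] at h
    exact ⟨σ, hσ.insert (h.trans hya), rfl⟩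

/-! ### Pre-resolutions -/

section PreResolution

variable {N : ℕ} {C : Set (Imaginary L M)} {a : Fin N → Imaginary L M}

theorem repSet_finite (W : ∀ n, OpaquePresentation (initialParams C a n) (a n))
    (I : Set (Fin N)) : (repSet W I).Finite := by
  refine (Set.finite_iUnion fun i => Set.finite_range (W i).b.1).subset ?_
  rintro _ ⟨i, -, j, rfl⟩
  exact Set.mem_iUnion.2 ⟨i, j, rfl⟩

theorem repSet_empty (W : ∀ n, OpaquePresentation (initialParams C a n) (a n)) :
    repSet W ∅ = ∅ := by
  ext
  simp [repSet]

theorem repSet_insert (W : ∀ n, OpaquePresentation (initialParams C a n) (a n)) (n : Fin N)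
    (I : Set (Fin N)) : repSet W (insert n I) = repSet W I ∪ Set.range (W n).b.1 := by
  ext x
  constructor
  · rintro ⟨i, rfl | hi, j, rfl⟩
    · exact Or.inr ⟨j, rfl⟩
    · exact Or.inl ⟨i, hi, j, rfl⟩
  · rintro (⟨i, hi, h⟩ | ⟨j, rfl⟩)
    · exact ⟨i, Or.inr hi, h⟩
    · exact ⟨n, Or.inl rfl, j, rfl⟩

theorem keptIndices_last (W : ∀ n, OpaquePresentation (initialParams C a n) (a n)) :
    keptIndices W (Fin.last N) = ∅ :=
  Fin.reverseInduction_last ..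

open Classical in
theorem keptIndices_castSucc (W : ∀ n, OpaquePresentation (initialParams C a n) (a n))
    (n : Fin N) : keptIndices W n.castSucc =
      if a n ∈ aclEq (initialParams C a n ∪ home L '' repSet W (keptIndices W n.succ))
      then keptIndices W n.succ else insert n (keptIndices W n.succ) :=
  Fin.reverseInduction_castSucc ..

/-- The parameters `C` and `a_i` for `i < n`, where `n` may be `N`. -/
def paramsBelow (C : Set (Imaginary L M)) (a : Fin N → Imaginary L M) (n : Fin (N + 1)) :
    Set (Imaginary L M) :=
  C ∪ {e | ∃ i : Fin N, i.castSucc < n ∧ e = a i}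

theorem paramsBelow_castSucc (n : Fin N) :
    paramsBelow C a n.castSucc = initialParams C a n := rfl

theorem paramsBelow_succ (n : Fin N) :
    paramsBelow C a n.succ = insert (a n) (initialParams C a n) := by
  ext e
  simp only [paramsBelow, initialParams, Set.mem_union, Set.mem_insert_iff, Set.mem_ofPred_eq,
    Fin.castSucc_lt_succ_iff, le_iff_lt_or_eq]
  grind

theorem paramsBelow_zero : paramsBelow C a 0 = C := by
  simp [paramsBelow]

theorem initialParams_subset (n : Fin N) : initialParams C a n ⊆ C ∪ Set.range a := by
  rintro e (he | ⟨i, -, rfl⟩)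
  · exact Or.inl he
  · exact Or.inr ⟨i, rfl⟩

/-- The two claims are proved together: algebraicity of the later `a j` is what allows isolation
over `a n` and the earlier parameters to be extended to the whole sequence. -/
theorem IsMonster.preResolution {κ : Cardinal.{w}} (hM : IsMonster L M κ) (hC : #C < κ)
    (W : ∀ n, OpaquePresentation (initialParams C a n) (a n)) (n : Fin (N + 1)) :
    OrbitIsolated (C ∪ Set.range a) (Subtype.val : chosenReps W n → M) ∧
      ∀ j : Fin N, n ≤ j.castSucc →
        (imOrbit (paramsBelow C a n ∪ home L '' chosenReps W n) (a j)).Finite := by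
  have hCa : #(C ∪ Set.range a : Set (Imaginary L M)) < κ :=
    hM.mk_union_lt hC (hM.mk_lt_of_finite (Set.finite_range a))
  induction n using Fin.reverseInduction with
  | last =>
    have : chosenReps W (Fin.last N) = ∅ := by
      rw [chosenReps, keptIndices_last, repSet_empty]
    rw [this]
    exact ⟨OrbitIsolated.of_finite_imOrbit fun i => i.2.elim,
      fun j hj => (hj.not_gt (Fin.castSucc_lt_last j)).elim⟩
  | cast n ih =>
    obtain ⟨ih₁, ih₂⟩ := ih
    set B := chosenReps W n.succ with hB
    have hBfin : B.Finite := repSet_finite W _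
    have hsmall : #(initialParams C a n ∪ home L '' B : Set (Imaginary L M)) < κ :=
      hM.mk_union_lt ((mk_le_mk_of_subset (initialParams_subset n)).trans_lt hCa)
        (hM.mk_lt_of_finite (hBfin.image _))
    rw [paramsBelow_succ, Set.insert_union] at ih₂
    rw [paramsBelow_castSucc]
    have hlt : ∀ j : Fin N, n.castSucc ≤ j.castSucc → j = n ∨ n.succ ≤ j.castSucc := by
      intro j hj
      rw [Fin.succ_le_castSucc_iff]
      exact (Fin.castSucc_le_castSucc_iff.1 hj).eq_or_lt.imp Eq.symm id
    by_cases h : a n ∈ aclEq (initialParams C a n ∪ home L '' B)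
    · have hB' : chosenReps W n.castSucc = B := by
        rw [chosenReps, keptIndices_castSucc]
        exact congrArg (repSet W) (if_pos h)
      rw [hB']
      have han := (hM.mem_aclEq_iff hsmall).1 h
      refine ⟨ih₁, fun j hj => ?_⟩
      obtain rfl | hj := hlt j hj
      · exact han
      · exact imOrbit_finite_of_insert han (ih₂ j hj)
    · have hB' : chosenReps W n.castSucc = B ∪ Set.range (W n).b.1 := by
        rw [chosenReps, keptIndices_castSucc]
        exact (congrArg (repSet W) (if_neg h)).trans (repSet_insert ..)
      rw [hB']
      have hb := hM.orbitIsolated_representative (W n) Set.subset_union_left hsmall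
        (fun h' => h ((hM.mem_aclEq_iff hsmall).2 h'))
      -- Earlier `a j` are already in the base, and later ones are algebraic over it by induction.
      have hb' := hM.orbitIsolated_union (by
        rw [Set.insert_eq]
        exact hM.mk_union_lt (hM.mk_lt_of_finite (Set.finite_singleton _)) hsmall) hb
        (Set.finite_range a) (by
          rintro _ ⟨j, rfl⟩
          rcases lt_or_ge j n with hj | hj
          · exact imOrbit_finite_of_mem (Or.inr (Or.inl (Or.inr ⟨j, hj, rfl⟩)))
          · obtain rfl | hj := hlt j (Fin.castSucc_le_castSucc_iff.2 hj)
            · exact imOrbit_finite_of_mem (Or.inl rfl)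
            · exact ih₂ j hj)
      have heq : insert (a n) (initialParams C a n ∪ home L '' B) ∪ Set.range a =
          (C ∪ Set.range a) ∪ home L '' Set.range (Subtype.val : B → M) := by
        rw [Subtype.range_coe]
        refine Set.Subset.antisymm ?_ ?_
        · refine Set.union_subset (Set.insert_subset (Or.inl (Or.inr ⟨n, rfl⟩))
            (Set.union_subset_union_left _ (initialParams_subset n))) ?_
          exact Set.subset_union_right.trans Set.subset_union_left
        · rintro e ((he | he) | he)
          · exact Or.inl (Or.inr (Or.inl (Or.inl he)))
          · exact Or.inr he
          · exact Or.inl (Or.inr (Or.inr he))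
      have := hBfin.to_subtype
      refine ⟨hM.orbitIsolated_of_range_eq_union hCa ih₁ (heq ▸ hb') (by
        rw [Subtype.range_coe, Subtype.range_coe]), fun j hj => ?_⟩
      -- The class of `b_n` is fixed as soon as `A_n` and `b_n` are.
      have han : (imOrbit (initialParams C a n ∪ home L '' (B ∪ Set.range (W n).b.1))
          (a n)).Finite := imOrbit_finite_of_fixed fun σ hσ =>
        (W n).act_eq_of_comp_b (hσ.mono Set.subset_union_left)
          (fixes_home_range_iff.1 (hσ.mono
            ((Set.image_mono Set.subset_union_right).trans Set.subset_union_right)))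
      obtain rfl | hj := hlt j hj
      · exact han
      · exact imOrbit_finite_of_insert han ((ih₂ j hj).subset (imOrbit_anti
          (Set.insert_subset_insert (Set.union_subset_union_right _
            (Set.image_mono Set.subset_union_left)))))

end PreResolution

/-! ### Algebraic closure in the home sort -/

section HomeAcl

variable {S D : Set M} {x : M}

theorem imOrbit_finite_of_mem_acl (hx : x ∈ acl L S) :
    (imOrbit (home L '' S) (home L x)).Finite := by
  obtain ⟨X, hX, hxX, hdef⟩ := hx
  refine (hX.image (home L)).subset ?_
  rintro _ ⟨σ, hσ, rfl⟩
  exact ⟨σ x, (definable_apply_iff hdef σ (fixes_home_image_iff.1 hσ) fun _ => x).2 hxX, rfl⟩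

theorem subset_acl : S ⊆ acl L S := fun x hx =>
  ⟨{x}, Set.finite_singleton x, rfl, Set.Definable.singleton_of_mem L hx⟩

theorem IsMonster.mem_acl_iff {κ : Cardinal.{w}} (hM : IsMonster L M κ) (hS : #S < κ) :
    x ∈ acl L S ↔ (imOrbit (home L '' S) (home L x)).Finite := by
  refine ⟨imOrbit_finite_of_mem_acl, fun h => ?_⟩
  have hX : (home L ⁻¹' imOrbit (home L '' S) (home L x)).Finite :=
    h.preimage home_injective.injOn
  refine ⟨_, hX, mem_imOrbit_self, DefinableOver.definable_of_home
    (hM.definableOver_of_invariant (mk_image_le.trans_lt hS) (definable_of_finite ?_)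
      fun σ hσ z hz => act_mem_imOrbit hz hσ)⟩
  refine hX.preimage (f := fun z : Fin 1 → M => z 0) fun y _ z _ h => funext fun i => ?_
  rw [Subsingleton.elim i 0]
  exact h

theorem IsMonster.acl_acl {κ : Cardinal.{w}} (hM : IsMonster L M κ) (hS : #S < κ) :
    acl L (acl L S) = acl L S := by
  refine Set.Subset.antisymm ?_ subset_acl
  rintro x ⟨X, hX, hxX, hdef⟩
  obtain ⟨T, hT, hdef'⟩ := Set.definable_iff_finitely_definable.1 hdef
  rw [hM.mem_acl_iff hS]
  refine imOrbit_finite_of_union (T.finite_toSet.image (home L)) ?_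
    ((imOrbit_finite_of_mem_acl ⟨X, hX, hxX, hdef'⟩).subset (imOrbit_anti Set.subset_union_right))
  rintro _ ⟨y, hy, rfl⟩
  exact imOrbit_finite_of_mem_acl (hT hy)

/-- The Tarski–Vaught property. -/
theorem exists_mem_of_definable (S : L.ElementarySubstructure M) [Finite α] {X : Set (α → M)}
    (hX : (S : Set M).Definable L X) (hne : X.Nonempty) :
    ∃ x ∈ X, Set.range x ⊆ (S : Set M) := by
  obtain ⟨φ, rfl⟩ := Set.definable_iff_exists_formula_sum.1 hX
  obtain ⟨x, hx⟩ := hne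
  have h₁ : (φ.iExs α).Realize (S.subtype ∘ id) := Formula.realize_iExs.2 ⟨x, hx⟩
  obtain ⟨y, hy⟩ := Formula.realize_iExs.1 ((S.subtype.map_formula _ _).1 h₁)
  refine ⟨S.subtype ∘ y, ?_, ?_⟩
  · have h₂ := (S.subtype.map_formula _ _).2 hy
    rwa [Sum.comp_elim] at h₂
  · rintro _ ⟨i, rfl⟩
    exact (y i).2

/-- Take a finite `D`-definable set `F` of classes containing `e`, and remove the classes with a
representative in `S`. What remains is still definable over `S`; were `e` left in it, elementarity
would produce a representative in `S` of a remaining class. -/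
theorem exists_mem_cls_of_mem_aclEq (S : L.ElementarySubstructure M) {e : Imaginary L M}
    (hD : D ⊆ S) (he : e ∈ aclEq (home L '' D)) :
    ∃ r ∈ e.cls, Set.range r ⊆ (S : Set M) := by
  obtain ⟨F, hF, heF, hdef⟩ := he
  let F' : Set (Quotient e.1.rel) :=
    {q | q ∈ F ∧ ∃ r, Quotient.mk e.1.rel r = q ∧ Set.range r ⊆ (S : Set M)}
  have hF' : (S : Set M).Definable L {r | Quotient.mk e.1.rel r ∈ F'} :=
    definable_reps_of_finite e.1 (hF.subset fun q hq => hq.1) fun q hq => hq.2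
  by_contra hcon
  obtain ⟨r, hr⟩ := exists_mem_cls e
  obtain ⟨x, ⟨hxF, hxF'⟩, hxS⟩ := exists_mem_of_definable S
    ((hdef.definable_of_home.mono hD).sdiff hF')
    ⟨r, by rwa [Set.mem_ofPred_eq, mem_cls_iff.1 hr], fun h => hcon (by
      obtain ⟨-, r', hr', hr'S⟩ := h
      exact ⟨r', hr'.trans hr, hr'S⟩)⟩
  exact hxF' ⟨hxF, x, rfl, hxS⟩

end HomeAcl

/-! ### Resolutions -/

theorem IsMonster.fixes_of_dclEq_eq {κ : Cardinal.{w}} (hM : IsMonster L M κ)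
    {A B : Set (Imaginary L M)} (hA : #A < κ) (hB : #B < κ) (h : dclEq A = dclEq B)
    {σ : M ≃[L] M} (hσ : Fixes σ A) : Fixes σ B := fun e he => by
  have heA : e ∈ dclEq A := h ▸ (hM.mem_dclEq_iff hB).2 fun τ hτ => hτ e he
  exact (hM.mem_dclEq_iff hA).1 heA σ hσ

theorem IsMonster.exists_resolution {κ : Cardinal.{w}} (hM : IsMonster L M κ)
    (hacl : AclSetsAreModels L M) {C : Set M} (hC : #C < κ) {N : ℕ}
    {a : Fin N → Imaginary L M} (ha : IsWeaklyOpaquelyLayered (home L '' C) a) :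
    ∃ B F₀ : Set M, F₀.Finite ∧ B = C ∪ F₀ ∧
      home L '' C ∪ Set.range a ⊆ dclEq (home L '' B) ∧
      ∀ F : Set M, F.Finite → F₀ ⊆ F → F ⊆ B →
        RelIsolatedSet (home L '' C ∪ Set.range a) F := by
  obtain ⟨n, s, hs, hdcl⟩ := ha
  let W := fun i => (hs i).some
  have hC' : #(home L '' C) < κ := mk_image_le.trans_lt hC
  have hCs : #(home L '' C ∪ Set.range s : Set (Imaginary L M)) < κ :=
    hM.mk_union_lt hC' (hM.mk_lt_of_finite (Set.finite_range s))
  have hCa : #(home L '' C ∪ Set.range a : Set (Imaginary L M)) < κ :=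
    hM.mk_union_lt hC' (hM.mk_lt_of_finite (Set.finite_range a))
  obtain ⟨hiso, hsorb⟩ := hM.preResolution hC' W 0
  have hB₀ : (chosenReps W 0).Finite := repSet_finite W _
  set B₀ := chosenReps W 0
  rw [paramsBelow_zero, ← Set.image_union] at hsorb
  have hCB : #(C ∪ B₀ : Set M) < κ := hM.mk_union_lt hC (hM.mk_lt_of_finite hB₀)
  obtain ⟨S, hS⟩ := hacl _ (hM.acl_acl hCB)
  choose r hr hrS using fun j => exists_mem_cls_of_mem_aclEq S (hS ▸ subset_acl)
    ((hM.mem_aclEq_iff (mk_image_le.trans_lt hCB)).2 (hsorb j (Fin.zero_le _)))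
  -- Representatives of the `s j` in the model `acl(C ∪ B₀)`. They put the sequence, hence `a`, into
  -- the definable closure of `C` and `t`.
  let t : (Σ j, Fin (s j).arity) → M := fun p => r p.1 p.2
  have ht : Represents s t := hr
  have htacl : ∀ p, t p ∈ acl L (C ∪ B₀) := fun p => hS ▸ hrS p.1 ⟨p.2, rfl⟩
  have hF₀ : (B₀ ∪ Set.range t).Finite := hB₀.union (Set.finite_range t)
  have := hB₀.to_subtype
  have := hF₀.to_subtype
  refine ⟨_, B₀ ∪ Set.range t, hF₀, rfl, ?_, fun F hF hF₀F hFB => ?_⟩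
  · have hB : #(home L '' (C ∪ (B₀ ∪ Set.range t))) < κ :=
      mk_image_le.trans_lt (hM.mk_union_lt hC (hM.mk_lt_of_finite hF₀))
    intro e he
    rw [hM.mem_dclEq_iff hB]
    intro σ hσ
    refine hM.fixes_of_dclEq_eq hCs hCa hdcl ?_ e he
    refine (hσ.mono (Set.image_mono Set.subset_union_left)).union ?_
    rintro _ ⟨j, rfl⟩
    refine ht.act_eq ?_ j
    rw [fixes_home_range_iff.1 (hσ.mono (Set.image_mono
      (Set.subset_union_right.trans Set.subset_union_right)))]
    exact ht
  · have := hF.to_subtype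
    -- Over `C`, the sequence `s` and the tuple `a` have the same stabilizer, so isolation may be
    -- proved over `s`.
    refine (hM.relIsolated_iff hCa).2 (OrbitIsolated.congr (A := home L '' C ∪ Set.range s) ?_
      fun σ => ⟨hM.fixes_of_dclEq_eq hCs hCa hdcl, hM.fixes_of_dclEq_eq hCa hCs hdcl.symm⟩)
    have h₁ : OrbitIsolated (home L '' C ∪ Set.range s)
        (Subtype.val : ↥(B₀ ∪ Set.range t) → M) := by
      refine hM.orbitIsolated_of_range_eq_union hCs hiso
        (OrbitIsolated.of_finite_imOrbit (x := t) fun p => ?_) ?_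
      · refine (imOrbit_finite_of_mem_acl (htacl p)).subset (imOrbit_anti ?_)
        rw [Set.image_union, Subtype.range_coe]
        exact Set.union_subset_union_left _ Set.subset_union_left
      · rw [Subtype.range_coe, Subtype.range_coe]
    -- The remaining elements of `F` lie in `C`, already part of the base.
    refine hM.orbitIsolated_of_range_eq_union hCs h₁
      (OrbitIsolated.of_finite_imOrbit (x := (Subtype.val : F → M)) fun p => ?_) ?_
    · refine imOrbit_finite_of_mem ?_
      rw [Subtype.range_coe]
      exact (hFB p.2).imp (fun h => Or.inl ⟨_, h, rfl⟩) (fun h => ⟨_, h, rfl⟩)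
    · rw [Subtype.range_coe, Subtype.range_coe, Set.union_eq_self_of_subset_left hF₀F]

end WeakOpacity

/-! ### Pre-resolutions and resolutions in a monster model -/

theorem mainTheorem8 {L : FirstOrder.Language.{u, v}} {M : Type w} [L.Structure M] [Nonempty M]
    (T : L.Theory) (hT : T.IsComplete) (hMT : M ⊨ T)
    (κ : Cardinal.{w}) (hM : WeakOpacity.IsMonster L M κ) :
    -- pre-resolutions of weakly opaque sequences
    (∀ (C : Set (WeakOpacity.Imaginary L M)), #C < κ →
      ∀ (N : ℕ) (a : Fin N → WeakOpacity.Imaginary L M)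
        (W : ∀ n, WeakOpacity.OpaquePresentation (WeakOpacity.initialParams C a n) (a n)),
        Set.range a ⊆ WeakOpacity.aclEq
          (WeakOpacity.home L '' WeakOpacity.chosenReps W 0 ∪ C) ∧
        WeakOpacity.RelIsolatedSet (C ∪ Set.range a) (WeakOpacity.chosenReps W 0)) ∧
    -- resolutions of weakly opaquely layered tuples
    (WeakOpacity.AclSetsAreModels L M → WeakOpacity.CodesFiniteSets L M →
      ∀ (C : Set M), #C < κ →
      ∀ (N : ℕ) (a : Fin N → WeakOpacity.Imaginary L M),
        WeakOpacity.IsWeaklyOpaquelyLayered (WeakOpacity.home L '' C) a →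
        ∃ B F₀ : Set M, F₀.Finite ∧ B = C ∪ F₀ ∧
          WeakOpacity.home L '' C ∪ Set.range a ⊆ WeakOpacity.dclEq (WeakOpacity.home L '' B) ∧
          ∀ F : Set M, F.Finite → F₀ ⊆ F → F ⊆ B →
            WeakOpacity.RelIsolatedSet (WeakOpacity.home L '' C ∪ Set.range a) F) := by
  refine ⟨fun C hC N a W => ?_, fun hacl _ C hC N a ha => hM.exists_resolution hacl hC ha⟩
  obtain ⟨hiso, horb⟩ := hM.preResolution hC W 0
  have hfin : (WeakOpacity.chosenReps W 0).Finite := WeakOpacity.repSet_finite W _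
  have := hfin.to_subtype
  refine ⟨?_, (hM.relIsolated_iff (hM.mk_union_lt hC
    (hM.mk_lt_of_finite (Set.finite_range a)))).2 hiso⟩
  rintro _ ⟨j, rfl⟩
  rw [Set.union_comm, hM.mem_aclEq_iff (hM.mk_union_lt hC (hM.mk_lt_of_finite (hfin.image _)))]
  have h := horb j (Fin.zero_le _)
  rwa [WeakOpacity.paramsBelow_zero] at h
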